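/- Let $p$ independent data streams $(X_{k,\ell})_{\ell\ge1}$, $k=1,\dots,p$, be observed. Under $P_\infty$ all observations are i.i.d. $N(0,1)$. For $\mu\in[0,\infty)^p$ and an integer $\nu\ge1$, under $P_{\mu,\nu}$ all observations are independent, with $X_{k,\ell}\sim N(0,1)$ for $\ell<\nu$ and $X_{k,\ell}\sim N(\mu_k,1)$ for $\ell\ge\nu$. Let $\mathcal F_{n}$ be the $\sigma$-algebra generated by the observations at times $1,\dots,n$. Given constants $\omega_1,\dots,\omega_p>0$, put, for $1\le m<\ell$, $\bar X_{k,m,\ell}=\frac{1}{\ell-m}\sum_{i=m}^{\ell-1}X_{k,i}$, and define the hard-thresholding estimates $\hat\mu_{k,m,\ell}=\bar X_{k,m,\ell}$ if $\bar X_{k,m,\ell}\ge\omega_k$, $\hat\mu_{k,m,\ell}=0$ otherwise, and $\hat\mu_{k,m,m}=0$. With $f_\theta$ the density of $N(\theta,1)$, let $$\Lambda_{n,m}=\prod_{\ell=m}^{n}\prod_{k=1}^{p}\frac{f_{\hat\mu_{k,m,\ell}}(X_{k,\ell})}{f_0(X_{k,\ell})},\qquad N_B=\inf\Big\{n\ge1:\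 \sum_{m=1}^{n}\Lambda_{n,m}\ge B\Big\}$$ (with $\inf\emptyset=\infty$). The worst-case detection delay of a stopping time $N$ is $$D_\mu(N)=\sup_{1\le\nu<\infty}\operatorname{ess\,sup}\ E_{\mu,\nu}\big(N-\nu+1\mid N\ge\nu,\ \mathcal F_{\nu-1}\big).$$ Then: (i) $E_\infty(N_B)\ge B$ for all $0<B<\infty$. (ii) Let $\mu\in[0,\infty)^p$, $\Omega=\{k:\mu_k\ge\omega_k\}$, $r=|\Omega|$ and $I=\frac12\sum_{k\in\Omega}\mu_k^2$. If $I>0$ and $\mu_k\ne\omega_k$ for all $k$, then, as $B\to\infty$ with $p$, $\mu$ and $\omega$ fixed, $$D_\mu(N_B)\le\frac{\log B+\frac r2\log\log B-\frac r2\log I}{I}+o(r\log\log B);$$ in particular, $D_\mu(N_B)$ is finite for all large $B$. -/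

import Mathlib

open MeasureTheory ProbabilityTheory Filter Asymptotics
open scoped ENNReal

noncomputable section

namespace SRRS

/-- A realization of `p` real-valued data streams: `x ℓ k` is the observation at time `ℓ` from the
`k`-th stream. Monitoring starts at time `1`; the coordinate `ℓ = 0` is used by nothing below. -/
abbrev Path (p : ℕ) : Type := ℕ → Fin p → ℝ

/-- The law under which all observations are independent and the one at time `ℓ` from stream `k`
has distribution `N(mean ℓ k, 1)`. -/
def streamLaw {p : ℕ} (mean : ℕ → Fin p → ℝ) : Measure (Path p) :=
  Measure.infinitePi fun ℓ : ℕ => Measure.pi fun k : Fin p => gaussianReal (mean ℓ k) 1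

instance {p : ℕ} (mean : ℕ → Fin p → ℝ) : IsProbabilityMeasure (streamLaw mean) := by
  unfold streamLaw; infer_instance

/-- The law `P_∞`: no change ever happens, all observations are standard normal. -/
def lawNoChange (p : ℕ) : Measure (Path p) := streamLaw fun _ _ => 0

/-- The law `P_{μ,ν}`: at time `ν` the mean vector changes from `0` to `μ`. -/
def lawChangeAt {p : ℕ} (μ : Fin p → ℝ) (ν : ℕ) : Measure (Path p) :=
  streamLaw fun ℓ k => if ν ≤ ℓ then μ k else 0

/-- The σ-algebra `F_{ν-1}` generated by the observations at times `1, …, ν - 1`. -/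
@[reducible] def pastOf (p ν : ℕ) : MeasurableSpace (Path p) :=
  ⨆ ℓ ∈ Finset.Ico 1 ν, MeasurableSpace.comap (fun x : Path p => x ℓ) inferInstance

theorem pastOf_le (p ν : ℕ) : pastOf p ν ≤ (inferInstance : MeasurableSpace (Path p)) :=
  iSup₂_le fun ℓ _ => (measurable_pi_apply ℓ).comap_le

/-- The average of the observations of stream `k` at times `m, …, ℓ - 1`
(equal to `0` when there are none, i.e. `ℓ = m`). -/
def sampleMean {p : ℕ} (k : Fin p) (m ℓ : ℕ) (x : Path p) : ℝ :=
  (∑ i ∈ Finset.Ico m ℓ, x i k) / ((ℓ : ℝ) - (m : ℝ))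

/-- The hard-thresholding estimator of the post-change mean of stream `k` from the observations at
times `m, …, ℓ - 1`. As the thresholds are positive, it is `0` when `ℓ = m`. -/
def muHat {p : ℕ} (ω : Fin p → ℝ) (k : Fin p) (m ℓ : ℕ) (x : Path p) : ℝ :=
  if ω k ≤ sampleMean k m ℓ x then sampleMean k m ℓ x else 0

/-- The plug-in likelihood ratio `Λ_{n,m}` at time `n` for a change at time `m`. -/
def likelihoodRatio {p : ℕ} (ω : Fin p → ℝ) (n m : ℕ) (x : Path p) : ℝ :=
  ∏ ℓ ∈ Finset.Icc m n, ∏ k : Fin p,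
    gaussianPDFReal (muHat ω k m ℓ x) 1 (x ℓ k) / gaussianPDFReal 0 1 (x ℓ k)

/-- The detection statistic `∑_{m=1}^n Λ_{n,m}`. -/
def statistic {p : ℕ} (ω : Fin p → ℝ) (n : ℕ) (x : Path p) : ℝ :=
  ∑ m ∈ Finset.Icc 1 n, likelihoodRatio ω n m x

/-- The alarm time `N_B = inf {n ≥ 1 : ∑_{m=1}^n Λ_{n,m} ≥ B}`, with value `⊤` if there is no
such `n`. -/
def alarmTime {p : ℕ} (ω : Fin p → ℝ) (B : ℝ) : Path p → ℕ∞ :=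
  hittingAfter (statistic ω) (Set.Ici B) 1

/-- The average run length to false alarm `E_∞(N)`. -/
def runLength {p : ℕ} (N : Path p → ℕ∞) : ℝ≥0∞ :=
  ∫⁻ x, (N x : ℝ≥0∞) ∂(lawNoChange p)

/-- The worst-case detection delay
`D_μ(N) = sup_{1 ≤ ν < ∞} ess sup E_{μ,ν}(N - ν + 1 | N ≥ ν, F_{ν-1})`:
the conditional expectation given `F_{ν-1}`, with the essential supremum over the event `{N ≥ ν}`.
On that event `N + 1 - ν` is an honest (not truncated) difference. -/
def detectionDelay {p : ℕ} (μ : Fin p → ℝ) (N : Path p → ℕ∞) : ℝ≥0∞ :=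
  ⨆ (ν : ℕ) (_ : 1 ≤ ν),
    essSup (condLExp (pastOf p ν) (lawChangeAt μ ν) fun x => (N x : ℝ≥0∞) + 1 - (ν : ℝ≥0∞))
      ((lawChangeAt μ ν).restrict {x | (ν : ℕ∞) ≤ N x})

/-- The set `Ω = {k : μ_k ≥ ω_k}`. -/
def exceedSet {p : ℕ} (ω μ : Fin p → ℝ) : Finset (Fin p) :=
  Finset.univ.filter fun k => ω k ≤ μ k

/-- The information number `I = (1/2) ∑_{k ∈ Ω} μ_k²`. -/
def info {p : ℕ} (ω μ : Fin p → ℝ) : ℝ :=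
  (1 / 2) * ∑ k ∈ exceedSet ω μ, μ k ^ 2

end SRRS

end

/-! False alarms. The estimate used at time `ℓ` depends only on earlier observations, so under the
law without change each plug-in ratio is a martingale in `n`, and it starts at `1` because its first
estimate is `0`. Hence the statistic minus time is a martingale, and optional stopping gives `B *
P(N ≤ n) ≤ E(min(N, n + 1))`; let `n → ∞` (`stopped_statistic_le`, `ofReal_le_runLength`).

Delay. The statistic dominates its summand started at the change. That summand uses only data from
the change on, which are independent of the past, so the worst-case delay is at most the expected
time `t` at which a single plug-in ratio, fed with `N(μ, 1)` data, reaches `B`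
(`detectionDelay_le`).

A Wald argument bounds `t` (`exists_wald_bound`). The log ratio at the stopping time is at most `log
B` plus the last increment. Its mean is at least `I * t` minus half the accumulated squared
estimation error up to stopping. Each stream of `Ω` contributes at most `log t + O(1)` to that
error: the stopped discrete Itô formula for `S_n ^ 2 / n` yields `∑ P(still running at l) / (l +
1)`. The other streams contribute `O(1)`, since `μ k ≠ ω k` makes a wrong side of the threshold a
fourth-order event. The last increment has mean at most `δ * log t + C_δ` for any `δ > 0`. So `I * t
≤ log B + (r / 2 + δ) * log t + C_δ`; solving for `t` and using that `δ` is arbitrary gives the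
claim, the constant `(r / 2) * log I` being absorbed in the error term. -/

noncomputable section

namespace SRRS

/-! ### Gaussian noise, predictable weights and moments of partial sums. -/

section Noise

variable {Ω : Type*} {mΩ : MeasurableSpace Ω}

/-- A sequence of standard normal variables, adapted (with a shift) to a filtration and such that
each variable is independent of the strict past. -/
structure GaussianNoise (P : Measure Ω) (ℱ : Filtration ℕ mΩ) (Z : ℕ → Ω → ℝ) : Prop where
  meas : ∀ n, Measurable[ℱ (n + 1)] (Z n)
  law : ∀ n, P.map (Z n) = gaussianReal 0 1
  indep : ∀ n, Indep (ℱ n) (MeasurableSpace.comap (Z n) inferInstance) P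

variable {P : Measure Ω} {ℱ : Filtration ℕ mΩ} {Z : ℕ → Ω → ℝ}

theorem GaussianNoise.measurable (h : GaussianNoise P ℱ Z) (n : ℕ) : Measurable (Z n) :=
  (h.meas n).mono (ℱ.le _) le_rfl

theorem GaussianNoise.indepFun (h : GaussianNoise P ℱ Z) {n : ℕ} {f : Ω → ℝ}
    (hf : Measurable[ℱ n] f) {g : ℝ → ℝ} (hg : Measurable g) :
    IndepFun f (fun x => g (Z n x)) P := by
  refine indep_of_indep_of_le_left (indep_of_indep_of_le_right (h.indep n) ?_)
    (measurable_iff_comap_le.1 hf)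
  exact measurable_iff_comap_le.1 (hg.comp (Measurable.of_comap_le le_rfl))

/-- Partial sums of the noise. -/
def noiseSum (Z : ℕ → Ω → ℝ) (n : ℕ) (x : Ω) : ℝ := ∑ i ∈ Finset.range n, Z i x

theorem noiseSum_succ (Z : ℕ → Ω → ℝ) (n : ℕ) (x : Ω) :
    noiseSum Z (n + 1) x = noiseSum Z n x + Z n x := Finset.sum_range_succ _ _

theorem GaussianNoise.measurable_noiseSum (h : GaussianNoise P ℱ Z) (n : ℕ) :
    Measurable[ℱ n] (noiseSum Z n) := by
  unfold noiseSum
  refine Finset.measurable_fun_sum _ fun i hi => (h.meas i).mono (ℱ.mono ?_) le_rfl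
  have := Finset.mem_range.1 hi
  lia

/-- A predictable, decreasing, `[0, 1]`-valued sequence, such as the indicators of `{ℓ < τ}` for a
predictable time `τ`. -/
structure StopWeight (ℱ : Filtration ℕ mΩ) (a : ℕ → Ω → ℝ) : Prop where
  meas : ∀ n, Measurable[ℱ n] (a n)
  nonneg : ∀ n x, 0 ≤ a n x
  le_one : ∀ n x, a n x ≤ 1
  anti : ∀ n x, a (n + 1) x ≤ a n x

variable {a : ℕ → Ω → ℝ}

theorem StopWeight.measurable (h : StopWeight ℱ a) (n : ℕ) : Measurable (a n) :=
  (h.meas n).mono (ℱ.le _) le_rfl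

theorem StopWeight.abs_le_one (h : StopWeight ℱ a) (n : ℕ) (x : Ω) : |a n x| ≤ 1 :=
  _root_.abs_le.2 ⟨by linarith [h.nonneg n x], h.le_one n x⟩

theorem StopWeight.integrable_mul (h : StopWeight ℱ a) (n : ℕ) {f : Ω → ℝ} (hf : Integrable f P) :
    Integrable (fun x => a n x * f x) P :=
  hf.bdd_mul (h.measurable n).aestronglyMeasurable (ae_of_all _ (h.abs_le_one n))

theorem GaussianNoise.integrable_comp (h : GaussianNoise P ℱ Z) (n : ℕ) {g : ℝ → ℝ}
    (hg : Integrable g (gaussianReal 0 1)) : Integrable (fun x => g (Z n x)) P := by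
  rw [← h.law n] at hg
  exact hg.comp_measurable (h.measurable n)

theorem GaussianNoise.integral_comp (h : GaussianNoise P ℱ Z) (n : ℕ) {g : ℝ → ℝ}
    (hg : Measurable g) : ∫ x, g (Z n x) ∂P = ∫ z, g z ∂(gaussianReal 0 1) := by
  rw [← h.law n, integral_map (h.measurable n).aemeasurable hg.aestronglyMeasurable]

theorem GaussianNoise.integrable_mul (h : GaussianNoise P ℱ Z) {n : ℕ} {f : Ω → ℝ}
    (hf : Measurable[ℱ n] f) (hfi : Integrable f P) {g : ℝ → ℝ} (hg : Measurable g)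
    (hgi : Integrable g (gaussianReal 0 1)) : Integrable (fun x => f x * g (Z n x)) P :=
  (h.indepFun hf hg).integrable_mul hfi (h.integrable_comp n hgi)

theorem GaussianNoise.integral_mul (h : GaussianNoise P ℱ Z) {n : ℕ} {f : Ω → ℝ}
    (hf : Measurable[ℱ n] f) {g : ℝ → ℝ} (hg : Measurable g) :
    ∫ x, f x * g (Z n x) ∂P = (∫ x, f x ∂P) * ∫ z, g z ∂(gaussianReal 0 1) := by
  rw [← h.integral_comp n hg]
  exact (h.indepFun hf hg).integral_fun_mul_eq_mul_integral
    (hf.mono (ℱ.le _) le_rfl).aestronglyMeasurable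
    (hg.comp (h.measurable n)).aestronglyMeasurable

theorem integrable_pow_gaussianReal (q : ℕ) :
    Integrable (fun z : ℝ => z ^ q) (gaussianReal 0 1) := by
  have := (memLp_id_gaussianReal (μ := 0) (v := 1) q).integrable_norm_pow'
  exact (integrable_norm_iff (by fun_prop)).1 (by simpa using this)

theorem integral_sq_gaussianReal : ∫ z : ℝ, z ^ 2 ∂(gaussianReal 0 1) = 1 := by
  have := variance_fun_id_gaussianReal (μ := 0) (v := 1)
  rw [variance_eq_integral (by fun_prop)] at this
  simpa [integral_id_gaussianReal] using this

theorem integrable_exp_abs_gaussianReal (c : ℝ) :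
    Integrable (fun z : ℝ => Real.exp (c * |z|)) (gaussianReal 0 1) :=
  integrable_exp_mul_abs (integrable_exp_mul_gaussianReal c) (integrable_exp_mul_gaussianReal (-c))

theorem GaussianNoise.memLp (h : GaussianNoise P ℱ Z) (n q : ℕ) : MemLp (Z n) q P := by
  have := memLp_id_gaussianReal (μ := 0) (v := 1) q
  rw [← h.law n] at this
  exact (memLp_map_measure_iff (by fun_prop) (h.measurable n).aemeasurable).1 this

theorem StopWeight.integral_mul_le (h : StopWeight ℱ a) (n : ℕ) {f : Ω → ℝ} (hf : Integrable f P)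
    (h0 : ∀ x, 0 ≤ f x) : ∫ x, a n x * f x ∂P ≤ ∫ x, f x ∂P :=
  integral_mono (h.integrable_mul n hf) hf fun x => mul_le_of_le_one_left (h0 x) (h.le_one n x)

theorem GaussianNoise.memLp_noiseSum (h : GaussianNoise P ℱ Z) (n q : ℕ) :
    MemLp (noiseSum Z n) q P :=
  memLp_finsetSum _ fun i _ => h.memLp i q

theorem GaussianNoise.integrable_noiseSum_pow [IsFiniteMeasure P] (h : GaussianNoise P ℱ Z)
    (n q : ℕ) : Integrable (fun x => noiseSum Z n x ^ q) P := by
  refine (integrable_norm_iff ?_).1 (by simpa using (h.memLp_noiseSum n q).integrable_norm_pow')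
  exact (((h.measurable_noiseSum n).mono (ℱ.le _) le_rfl).pow_const q).aestronglyMeasurable

theorem GaussianNoise.integral_noiseSum (h : GaussianNoise P ℱ Z) (n : ℕ) :
    ∫ x, noiseSum Z n x ∂P = 0 := by
  unfold noiseSum
  rw [integral_finsetSum _ fun i _ => by
    simpa using h.integrable_comp i (integrable_pow_gaussianReal 1)]
  refine Finset.sum_eq_zero fun i _ => ?_
  rw [h.integral_comp i (g := fun z => z) (by fun_prop), integral_id_gaussianReal]

theorem StopWeight.integrable [IsFiniteMeasure P] (h : StopWeight ℱ a) (n : ℕ) :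
    Integrable (a n) P := by
  simpa using h.integrable_mul n (integrable_const (μ := P) (1 : ℝ))

variable [IsProbabilityMeasure P]

/-- The cross term vanishes because the weight and the partial sum are past-measurable while the new
variable is centred and independent of the past. -/
theorem GaussianNoise.integral_mul_noiseSum_succ_sq (h : GaussianNoise P ℱ Z) {n : ℕ} {a : Ω → ℝ}
    (ha : Measurable[ℱ n] a) (hb : ∀ x, |a x| ≤ 1) :
    ∫ x, a x * noiseSum Z (n + 1) x ^ 2 ∂P =
      (∫ x, a x * noiseSum Z n x ^ 2 ∂P) + ∫ x, a x ∂P := by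
  have ham : Measurable a := ha.mono (ℱ.le _) le_rfl
  have hbd : ∀ᵐ x ∂P, ‖a x‖ ≤ 1 := ae_of_all _ hb
  have i1 := (h.integrable_noiseSum_pow n 2).bdd_mul ham.aestronglyMeasurable hbd
  have i0 : Integrable a P := (integrable_const (1 : ℝ)).mono' ham.aestronglyMeasurable hbd
  have i2 := ((h.integrable_noiseSum_pow n 1).bdd_mul ham.aestronglyMeasurable hbd)
  have m2 : Measurable[ℱ n] fun x => a x * noiseSum Z n x ^ 1 :=
    ha.mul ((h.measurable_noiseSum n).pow_const 1)
  have j2 := h.integrable_mul m2 i2 (g := fun z => z) (by fun_prop)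
    (by simpa using integrable_pow_gaussianReal 1)
  have j3 := h.integrable_mul ha i0 (g := fun z => z ^ 2) (by fun_prop)
    (integrable_pow_gaussianReal 2)
  have e2 := h.integral_mul m2 (g := fun z => z) (by fun_prop)
  have e3 := h.integral_mul ha (g := fun z => z ^ 2) (by fun_prop)
  rw [integral_id_gaussianReal, mul_zero] at e2
  rw [integral_sq_gaussianReal, mul_one] at e3
  calc ∫ x, a x * noiseSum Z (n + 1) x ^ 2 ∂P
      = ∫ x, (a x * noiseSum Z n x ^ 2 + 2 * (a x * noiseSum Z n x ^ 1 * Z n x))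
          + a x * Z n x ^ 2 ∂P := by
        refine integral_congr_ae (ae_of_all _ fun x => ?_)
        simp only [noiseSum_succ]; ring
    _ = _ := by
        rw [integral_add (by fun_prop) j3, integral_add i1 (j2.const_mul 2),
          integral_const_mul, e2, e3]
        ring

theorem GaussianNoise.integral_noiseSum_sq (h : GaussianNoise P ℱ Z) (n : ℕ) :
    ∫ x, noiseSum Z n x ^ 2 ∂P = n := by
  induction n with
  | zero => simp [noiseSum]
  | succ n ih =>
    have := h.integral_mul_noiseSum_succ_sq (n := n) (a := fun _ => 1) measurable_const (by simp)
    simp only [one_mul] at this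
    rw [this, ih]; simp

/-- Fourth moments of the partial sums grow at most quadratically. -/
theorem GaussianNoise.integral_noiseSum_pow_four_le (h : GaussianNoise P ℱ Z) (n : ℕ) :
    ∫ x, noiseSum Z n x ^ 4 ∂P ≤ (3 + ∫ z : ℝ, z ^ 4 ∂(gaussianReal 0 1)) * (n : ℝ) ^ 2 := by
  set c := ∫ z : ℝ, z ^ 4 ∂(gaussianReal 0 1)
  have hc : 0 ≤ c := integral_nonneg fun z => by positivity
  -- The increment of the fourth moment is exactly `6 * n + c`, so the induction carries a quadratic
  -- and a linear term.
  suffices H : ∫ x, noiseSum Z n x ^ 4 ∂P ≤ 3 * (n : ℝ) ^ 2 + c * n by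
    have : (n : ℝ) ≤ (n : ℝ) ^ 2 := by exact_mod_cast Nat.le_self_pow two_ne_zero n
    nlinarith
  induction n with
  | zero => simp [noiseSum]
  | succ n ih =>
    have m := h.measurable_noiseSum n
    have i (q r : ℕ) : Integrable (fun x => noiseSum Z n x ^ q * Z n x ^ r) P :=
      h.integrable_mul (m.pow_const q) (h.integrable_noiseSum_pow n q) (g := fun z => z ^ r)
        (by fun_prop) (integrable_pow_gaussianReal r)
    have e (q r : ℕ) : ∫ x, noiseSum Z n x ^ q * Z n x ^ r ∂P =
        (∫ x, noiseSum Z n x ^ q ∂P) * ∫ z, z ^ r ∂(gaussianReal 0 1) :=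
      h.integral_mul (m.pow_const q) (g := fun z => z ^ r) (by fun_prop)
    have : ∫ x, noiseSum Z (n + 1) x ^ 4 ∂P =
        ∫ x, noiseSum Z n x ^ 4 * Z n x ^ 0 + 4 * (noiseSum Z n x ^ 3 * Z n x ^ 1)
          + 6 * (noiseSum Z n x ^ 2 * Z n x ^ 2) + 4 * (noiseSum Z n x ^ 1 * Z n x ^ 3)
          + noiseSum Z n x ^ 0 * Z n x ^ 4 ∂P := by
      refine integral_congr_ae (ae_of_all _ fun x => ?_)
      simp only [noiseSum_succ]; ring
    rw [this, integral_add (by fun_prop) (by fun_prop), integral_add (by fun_prop) (by fun_prop),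
      integral_add (by fun_prop) (by fun_prop), integral_add (by fun_prop) (by fun_prop),
      integral_const_mul, integral_const_mul, integral_const_mul, e, e, e, e, e,
      integral_sq_gaussianReal, h.integral_noiseSum_sq]
    simp only [pow_one, h.integral_noiseSum, integral_id_gaussianReal]
    simp only [pow_zero, integral_const, probReal_univ, smul_eq_mul, mul_one, mul_zero, zero_mul]
    push_cast
    change _ + 0 + 6 * (n : ℝ) + 0 + 1 * c ≤ _
    nlinarith [(Nat.cast_nonneg n : (0 : ℝ) ≤ n)]

/-- Discrete Itô formula for `S_n ^ 2 / n`, stopped. -/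
theorem GaussianNoise.sum_noiseSum_sq_le (h : GaussianNoise P ℱ Z) (ha : StopWeight ℱ a) (M : ℕ) :
    ∑ l ∈ Finset.range M, (∫ x, a (l + 1) x * noiseSum Z (l + 1) x ^ 2 ∂P) /
        (((l : ℝ) + 1) * ((l : ℝ) + 2)) +
      (∫ x, a (M + 1) x * noiseSum Z (M + 1) x ^ 2 ∂P) / ((M : ℝ) + 1)
      ≤ ∑ l ∈ Finset.range (M + 1), (∫ x, a l x ∂P) / ((l : ℝ) + 1) := by
  have key (l : ℕ) : ∫ x, a (l + 1) x * noiseSum Z (l + 1) x ^ 2 ∂P ≤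
      (∫ x, a l x * noiseSum Z l x ^ 2 ∂P) + ∫ x, a l x ∂P := by
    rw [← h.integral_mul_noiseSum_succ_sq (ha.meas l) (ha.abs_le_one l)]
    refine integral_mono (ha.integrable_mul _ (h.integrable_noiseSum_pow _ 2))
      (ha.integrable_mul _ (h.integrable_noiseSum_pow _ 2)) fun x => ?_
    exact mul_le_mul_of_nonneg_right (ha.anti l x) (sq_nonneg _)
  induction M with
  | zero => simpa [noiseSum] using key 0
  | succ M ih =>
    rw [Finset.sum_range_succ, Finset.sum_range_succ _ (M + 1)]
    have k := key (M + 1)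
    set u := ∫ x, a (M + 1) x * noiseSum Z (M + 1) x ^ 2 ∂P
    set v := ∫ x, a (M + 1 + 1) x * noiseSum Z (M + 1 + 1) x ^ 2 ∂P
    push_cast
    -- Summation by parts: the boundary term left by the induction hypothesis splits into the new
    -- summand and what `key` needs for the next boundary term.
    have e : u / (((M : ℝ) + 1) * ((M : ℝ) + 2)) = u / (M + 1) - u / (M + 1 + 1) := by
      field_simp; ring
    have d : v / ((M : ℝ) + 1 + 1) ≤ u / (M + 1 + 1) + (∫ x, a (M + 1) x ∂P) / (M + 1 + 1) := by
      rw [← add_div]; gcongr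
    rw [e]
    linarith

end Noise

/-! ### Elementary estimates: thresholding errors and weighted harmonic sums. -/

/-- Hard thresholding at level `w`. -/
def hardThreshold (w s : ℝ) : ℝ := if w ≤ s then s else 0

theorem measurable_hardThreshold (w : ℝ) : Measurable (hardThreshold w) :=
  Measurable.ite measurableSet_Ici measurable_id measurable_const

theorem hardThreshold_nonneg {w : ℝ} (hw : 0 ≤ w) (s : ℝ) : 0 ≤ hardThreshold w s := by
  unfold hardThreshold; split_ifs <;> linarith

theorem abs_hardThreshold_le (w s : ℝ) : |hardThreshold w s| ≤ |s| := by
  unfold hardThreshold; split_ifs <;> simp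

/-- The error of hard thresholding of a perturbed mean: on the exceeding side it is the error of
the mean, up to a contribution of fourth order. -/
theorem sq_hardThreshold_sub_le {w m : ℝ} (hw : 0 < w) (hm : 0 ≤ m) (hne : m ≠ w) :
    ∃ K : ℝ, 0 ≤ K ∧ ∀ y, (hardThreshold w (m + y) - hardThreshold w m) ^ 2 ≤
      (if w ≤ m then 1 else 0) * y ^ 2 + K * y ^ 4 := by
  rcases lt_or_gt_of_ne hne with h | h
  · have hd : 0 < w - m := by linarith
    -- An error occurs only if `y ≥ w - m`; then `m + y` is at most a multiple of `y`, and the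
    -- factor `y ^ 2 / (w - m) ^ 2 ≥ 1` raises the order to four.
    refine ⟨(m / (w - m) + 1) ^ 2 / (w - m) ^ 2, by positivity, fun y => ?_⟩
    simp only [hardThreshold, not_le.2 h, if_false, zero_mul, zero_add, sub_zero]
    split_ifs with h1
    · have hy : w - m ≤ y := by linarith
      have e1 : 0 ≤ m + y := by linarith
      have e2 : m + y ≤ (m / (w - m) + 1) * y := by
        have : m ≤ m / (w - m) * y := by
          rw [div_mul_eq_mul_div, le_div_iff₀ hd]; gcongr
        linarith
      have e3 : 1 ≤ y ^ 2 / (w - m) ^ 2 := by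
        rw [one_le_div (by positivity)]; gcongr
      calc (m + y) ^ 2 ≤ ((m / (w - m) + 1) * y) ^ 2 := by gcongr
        _ ≤ ((m / (w - m) + 1) * y) ^ 2 * (y ^ 2 / (w - m) ^ 2) :=
            le_mul_of_one_le_right (sq_nonneg _) e3
        _ = _ := by ring
    · simpa using by positivity
  · have hd : 0 < m - w := by linarith
    -- Falling below the threshold costs `m ^ 2` and forces `|y| ≥ m - w`, so `y ^ 4 / (m - w) ^ 4 ≥
    -- 1` can be inserted.
    refine ⟨m ^ 2 / (m - w) ^ 4, by positivity, fun y => ?_⟩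
    simp only [hardThreshold, h.le, if_true, one_mul]
    split_ifs with h1
    · have : 0 ≤ m ^ 2 / (m - w) ^ 4 * y ^ 4 := by positivity
      nlinarith
    · have hy : m - w ≤ -y := by linarith
      have e3 : 1 ≤ y ^ 4 / (m - w) ^ 4 := by
        rw [one_le_div (by positivity), ← Even.neg_pow (by decide : Even 4) y]; gcongr
      calc (0 - m) ^ 2 = m ^ 2 := by ring
        _ ≤ m ^ 2 * (y ^ 4 / (m - w) ^ 4) := le_mul_of_one_le_right (sq_nonneg _) e3
        _ ≤ y ^ 2 + m ^ 2 * (y ^ 4 / (m - w) ^ 4) := by nlinarith [sq_nonneg y]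
        _ = _ := by ring

theorem sum_inv_succ_mul_le (M : ℕ) :
    ∑ l ∈ Finset.range M, 1 / (((l : ℝ) + 1) * ((l : ℝ) + 2)) ≤ 1 := by
  suffices h : ∑ l ∈ Finset.range M, 1 / (((l : ℝ) + 1) * ((l : ℝ) + 2)) = 1 - 1 / ((M : ℝ) + 1) by
    rw [h]; have : 0 ≤ 1 / ((M : ℝ) + 1) := by positivity
    linarith
  induction M with
  | zero => simp
  | succ M ih => rw [Finset.sum_range_succ, ih]; push_cast; field_simp; ring

/-- With total mass `t` and weights at most `1`, the sum is largest when the mass sits on the first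
indices. Cutting at `⌈t⌉` leaves a harmonic sum and a tail of at most `t / ⌈t⌉ ≤ 1`. The bound does
not depend on `M`, so the truncation can later be removed. -/
theorem sum_div_succ_le_log {q : ℕ → ℝ} (h0 : ∀ l, 0 ≤ q l) (h1 : ∀ l, q l ≤ 1) (M : ℕ)
    (ht : 1 ≤ ∑ l ∈ Finset.range M, q l) :
    ∑ l ∈ Finset.range M, q l / ((l : ℝ) + 1) ≤ Real.log (∑ l ∈ Finset.range M, q l) + 3 := by
  set t := ∑ l ∈ Finset.range M, q l
  set n := ⌈t⌉₊
  have hn1 : t ≤ n := Nat.le_ceil t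
  have hn2 : (n : ℝ) ≤ 2 * t := by linarith [Nat.ceil_lt_add_one (by linarith : 0 ≤ t)]
  have hn : (0 : ℝ) < n := by linarith
  have hterm : ∀ l : ℕ, q l / ((l : ℝ) + 1) ≤ (if l < n then ((l : ℝ) + 1)⁻¹ else 0) + q l / n := by
    intro l
    have := h0 l
    split_ifs with h
    · have : q l / ((l : ℝ) + 1) ≤ 1 / ((l : ℝ) + 1) := by gcongr; exact h1 l
      have : 0 ≤ q l / n := by positivity
      rw [one_div] at *; linarith
    · have : (n : ℝ) ≤ l := by exact_mod_cast not_lt.1 h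
      rw [zero_add]; gcongr; linarith
  calc ∑ l ∈ Finset.range M, q l / ((l : ℝ) + 1)
      ≤ ∑ l ∈ Finset.range M, ((if l < n then ((l : ℝ) + 1)⁻¹ else 0) + q l / n) :=
        Finset.sum_le_sum fun l _ => hterm l
    _ = ∑ l ∈ Finset.range M with l < n, ((l : ℝ) + 1)⁻¹ + t / n := by
        rw [Finset.sum_add_distrib, Finset.sum_div, Finset.sum_filter]
    _ ≤ ∑ l ∈ Finset.range n, ((l : ℝ) + 1)⁻¹ + 1 := by
        gcongr
        · intro l hl
          simp_all
        · exact (div_le_one hn).2 hn1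
    _ ≤ (1 + Real.log n) + 1 := by
        gcongr
        have := harmonic_le_one_add_log n
        simpa [harmonic] using this
    _ ≤ (1 + Real.log (2 * t)) + 1 := by gcongr
    _ ≤ _ := by
        rw [Real.log_mul (by norm_num) (by linarith)]
        have := Real.log_two_lt_d9
        linarith

/-! ### Accumulated estimation error up to a stopping time. -/

section Noise

variable {Ω : Type*} {mΩ : MeasurableSpace Ω}

/-- The hard-thresholding estimate of the mean `m` from the first `n` of the observations
`m + Z i`. -/
def noiseEst (w m : ℝ) (Z : ℕ → Ω → ℝ) (n : ℕ) (x : Ω) : ℝ :=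
  hardThreshold w ((n * m + noiseSum Z n x) / n)

variable {P : Measure Ω} {ℱ : Filtration ℕ mΩ} {Z : ℕ → Ω → ℝ} {a : ℕ → Ω → ℝ}

theorem GaussianNoise.measurable_noiseEst (h : GaussianNoise P ℱ Z) (w m : ℝ) (n : ℕ) :
    Measurable[ℱ n] (noiseEst w m Z n) :=
  (measurable_hardThreshold w).comp
    ((measurable_const.add (h.measurable_noiseSum n)).div_const _)

theorem GaussianNoise.memLp_noiseEst [IsFiniteMeasure P] (h : GaussianNoise P ℱ Z) (w m : ℝ)
    (n q : ℕ) : MemLp (noiseEst w m Z n) q P := by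
  have : MemLp (fun x => (n : ℝ)⁻¹ * (n * m + noiseSum Z n x)) q P :=
    MemLp.const_mul (f := fun x => n * m + noiseSum Z n x)
      (MemLp.add (f := fun _ => (n : ℝ) * m) (memLp_const _) (h.memLp_noiseSum n q)) _
  refine this.mono ((h.measurable_noiseEst w m n).mono (ℱ.le _) le_rfl).aestronglyMeasurable
    (ae_of_all _ fun x => ?_)
  refine (abs_hardThreshold_le _ _).trans (le_of_eq ?_)
  rw [Real.norm_eq_abs, div_eq_inv_mul]

variable [IsProbabilityMeasure P]

theorem GaussianNoise.integrable_noiseEst_sub_sq (h : GaussianNoise P ℱ Z) (w m c : ℝ) (n : ℕ) :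
    Integrable (fun x => (noiseEst w m Z n x - c) ^ 2) P :=
  ((h.memLp_noiseEst w m n 2).sub (memLp_const c)).integrable_sq

/-- The accumulated squared error of the hard-thresholding estimates up to a stopping time. -/
theorem GaussianNoise.sum_integral_noiseEst_sub_sq_le (h : GaussianNoise P ℱ Z) {w m : ℝ}
    (hw : 0 < w) (hm : 0 ≤ m) (hne : m ≠ w) :
    ∃ K : ℝ, 0 ≤ K ∧ ∀ a, StopWeight ℱ a → ∀ M,
      ∑ l ∈ Finset.range M, ∫ x, a l x * (noiseEst w m Z l x - hardThreshold w m) ^ 2 ∂P ≤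
        (if w ≤ m then 1 else 0) * ∑ l ∈ Finset.range M, (∫ x, a l x ∂P) / ((l : ℝ) + 1) + K := by
  obtain ⟨K, hK, hy⟩ := sq_hardThreshold_sub_le hw hm hne
  set ι : ℝ := if w ≤ m then 1 else 0 with hι
  have hι0 : 0 ≤ ι := by rw [hι]; split_ifs <;> norm_num
  have hι1 : ι ≤ 1 := by rw [hι]; split_ifs <;> norm_num
  set θ := hardThreshold w m
  set c := 3 + ∫ z : ℝ, z ^ 4 ∂(gaussianReal 0 1)
  have hc : 0 ≤ c := add_nonneg (by norm_num) (integral_nonneg fun z => by positivity)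
  -- `θ ^ 2` is the error at `l = 0`, `1` the cost of replacing `(l + 1) ^ 2` by `(l + 1) * (l +
  -- 2)`, and `2 * (K * c)` the sum of the fourth-order terms.
  refine ⟨θ ^ 2 + (1 + 2 * (K * c)), by positivity, fun a ha M => ?_⟩
  have hnn (l : ℕ) : 0 ≤ ∫ x, a l x ∂P := integral_nonneg (ha.nonneg l)
  rcases M with _ | M
  · simp only [Finset.range_zero, Finset.sum_empty, mul_zero, zero_add]; positivity
  -- Without observations the mean is `0 / 0 = 0`, so the estimate is `0`.
  have h0 : ∫ x, a 0 x * (noiseEst w m Z 0 x - θ) ^ 2 ∂P ≤ θ ^ 2 := by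
    refine (ha.integral_mul_le 0 (h.integrable_noiseEst_sub_sq w m θ 0)
      fun x => sq_nonneg _).trans (le_of_eq ?_)
    simp [noiseEst, hardThreshold]
  have hstep (l : ℕ) : ∫ x, a (l + 1) x * (noiseEst w m Z (l + 1) x - θ) ^ 2 ∂P ≤
      ι * ((∫ x, a (l + 1) x * noiseSum Z (l + 1) x ^ 2 ∂P) / (((l : ℝ) + 1) * ((l : ℝ) + 2))) +
        (1 + 2 * (K * c)) * (1 / (((l : ℝ) + 1) * ((l : ℝ) + 2))) := by
    have i2 := ha.integrable_mul (l + 1) (h.integrable_noiseSum_pow (l + 1) 2)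
    have i4 := h.integrable_noiseSum_pow (l + 1) 4
    have hl : (0 : ℝ) < (l : ℝ) + 1 := by positivity
    have e1 : ∫ x, a (l + 1) x * (noiseEst w m Z (l + 1) x - θ) ^ 2 ∂P ≤
        ι * ((∫ x, a (l + 1) x * noiseSum Z (l + 1) x ^ 2 ∂P) / ((l : ℝ) + 1) ^ 2) +
          K * ((∫ x, noiseSum Z (l + 1) x ^ 4 ∂P) / ((l : ℝ) + 1) ^ 4) := by
      rw [← integral_div, ← integral_div, ← integral_const_mul, ← integral_const_mul,
        ← integral_add ((i2.div_const _).const_mul _) ((i4.div_const _).const_mul _)]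
      refine integral_mono (ha.integrable_mul _ (h.integrable_noiseEst_sub_sq _ _ _ _))
        (((i2.div_const _).const_mul _).add ((i4.div_const _).const_mul _)) fun x => ?_
      have := hy (noiseSum Z (l + 1) x / ((l : ℝ) + 1))
      have ea : m + noiseSum Z (l + 1) x / ((l : ℝ) + 1) =
          ((l + 1 : ℕ) * m + noiseSum Z (l + 1) x) / (l + 1 : ℕ) := by
        push_cast; field_simp
      rw [ea] at this
      calc a (l + 1) x * (noiseEst w m Z (l + 1) x - θ) ^ 2
          ≤ a (l + 1) x * (ι * (noiseSum Z (l + 1) x / ((l : ℝ) + 1)) ^ 2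
              + K * (noiseSum Z (l + 1) x / ((l : ℝ) + 1)) ^ 4) :=
            mul_le_mul_of_nonneg_left this (ha.nonneg _ _)
        _ ≤ a (l + 1) x * (ι * (noiseSum Z (l + 1) x / ((l : ℝ) + 1)) ^ 2)
              + K * (noiseSum Z (l + 1) x / ((l : ℝ) + 1)) ^ 4 := by
            rw [mul_add]
            exact add_le_add_right (mul_le_of_le_one_left (by positivity) (ha.le_one _ _)) _
        _ = _ := by simp only [div_pow]; ring
    have e2 : ∫ x, a (l + 1) x * noiseSum Z (l + 1) x ^ 2 ∂P ≤ (l : ℝ) + 1 := by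
      refine (ha.integral_mul_le _ (h.integrable_noiseSum_pow _ 2) fun x => sq_nonneg _).trans ?_
      rw [h.integral_noiseSum_sq]; simp
    have e4 := h.integral_noiseSum_pow_four_le (l + 1)
    set u := ∫ x, a (l + 1) x * noiseSum Z (l + 1) x ^ 2 ∂P
    set v := ∫ x, noiseSum Z (l + 1) x ^ 4 ∂P
    have hu : 0 ≤ u := integral_nonneg fun x => mul_nonneg (ha.nonneg _ _) (sq_nonneg _)
    push_cast at e4
    have f2 : u / ((l : ℝ) + 1) ^ 2 ≤ u / (((l : ℝ) + 1) * ((l : ℝ) + 2)) +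
        1 / (((l : ℝ) + 1) * ((l : ℝ) + 2)) := by
      have : u / ((l : ℝ) + 1) ^ 2 = u / (((l : ℝ) + 1) * ((l : ℝ) + 2)) +
          u / ((l : ℝ) + 1) * (1 / (((l : ℝ) + 1) * ((l : ℝ) + 2))) := by field_simp; ring
      rw [this]; gcongr
      exact mul_le_of_le_one_left (by positivity) ((div_le_one hl).2 e2)
    have f4 : v / ((l : ℝ) + 1) ^ 4 ≤ 2 * c * (1 / (((l : ℝ) + 1) * ((l : ℝ) + 2))) := by
      rw [div_le_iff₀ (by positivity)]
      refine e4.trans ?_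
      have : 2 * c * (1 / (((l : ℝ) + 1) * ((l : ℝ) + 2))) * ((l : ℝ) + 1) ^ 4 =
          c * ((l : ℝ) + 1) ^ 2 * (2 * ((l : ℝ) + 1) / ((l : ℝ) + 2)) := by field_simp
      rw [this]
      refine le_mul_of_one_le_right (by positivity) ?_
      rw [one_le_div (by positivity)]; linarith [(Nat.cast_nonneg l : (0 : ℝ) ≤ l)]
    refine e1.trans ?_
    have g2 := mul_le_mul_of_nonneg_left f2 hι0
    have g4 := mul_le_mul_of_nonneg_left f4 hK
    have hr : 0 ≤ 1 / (((l : ℝ) + 1) * ((l : ℝ) + 2)) := by positivity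
    have := mul_le_of_le_one_left hr hι1
    nlinarith
  rw [Finset.sum_range_succ']
  -- The weights are kept in the second-order term: dropping them would give `log M` in place of the
  -- logarithm of the expected stopping time.
  have hI := h.sum_noiseSum_sq_le ha M
  have hI' : ∑ l ∈ Finset.range M, (∫ x, a (l + 1) x * noiseSum Z (l + 1) x ^ 2 ∂P) /
      (((l : ℝ) + 1) * ((l : ℝ) + 2)) ≤
        ∑ l ∈ Finset.range (M + 1), (∫ x, a l x ∂P) / ((l : ℝ) + 1) := by
    refine le_trans (le_add_of_nonneg_right ?_) hI
    exact div_nonneg (integral_nonneg fun x => mul_nonneg (ha.nonneg _ _) (sq_nonneg _))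
      (by positivity)
  have hsum := Finset.sum_le_sum fun l (_ : l ∈ Finset.range M) => hstep l
  rw [Finset.sum_add_distrib, ← Finset.mul_sum, ← Finset.mul_sum] at hsum
  have k1 := mul_le_mul_of_nonneg_left hI' hι0
  have k2 := mul_le_mul_of_nonneg_left (sum_inv_succ_mul_le M)
    (by positivity : 0 ≤ 1 + 2 * (K * c))
  linarith

end Noise

/-! ### Drift and overshoot of the plug-in log-likelihood ratio; the Wald bound. -/

section Noise

variable {Ω : Type*} {mΩ : MeasurableSpace Ω}

/-- The increment of the plug-in log-likelihood ratio. -/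
def logIncr (w m : ℝ) (Z : ℕ → Ω → ℝ) (n : ℕ) (x : Ω) : ℝ :=
  noiseEst w m Z n x * (m + Z n x) - noiseEst w m Z n x ^ 2 / 2

theorem logIncr_le (w m θ : ℝ) (Z : ℕ → Ω → ℝ) (n : ℕ) (x : Ω) :
    logIncr w m Z n x ≤ |θ| * |Z n x| + (noiseEst w m Z n x - θ) * Z n x + m ^ 2 / 2 := by
  have h1 : θ * Z n x ≤ |θ| * |Z n x| := by rw [← abs_mul]; exact le_abs_self _
  unfold logIncr
  nlinarith [sq_nonneg (noiseEst w m Z n x - m)]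

variable {P : Measure Ω} [IsProbabilityMeasure P] {ℱ : Filtration ℕ mΩ} {Z : ℕ → Ω → ℝ}
  {a : ℕ → Ω → ℝ}

theorem GaussianNoise.integrable_logIncr (h : GaussianNoise P ℱ Z) (w m : ℝ) (n : ℕ) :
    Integrable (logIncr w m Z n) P := by
  have h1 : MemLp (noiseEst w m Z n) 2 P := by simpa using h.memLp_noiseEst w m n 2
  have h2 : MemLp (Z n) 2 P := by simpa using h.memLp n 2
  exact (h1.integrable_mul ((memLp_const m).add h2)).sub (h1.integrable_sq.div_const 2)

/-- The drift of the plug-in log-likelihood ratio. -/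
theorem GaussianNoise.le_integral_mul_logIncr (h : GaussianNoise P ℱ Z) (ha : StopWeight ℱ a)
    {w m : ℝ} (hw : 0 < w) (hm : 0 ≤ m) (n : ℕ) :
    (∫ x, a n x ∂P) * (hardThreshold w m ^ 2 / 2) -
        (∫ x, a n x * (noiseEst w m Z n x - hardThreshold w m) ^ 2 ∂P) / 2 ≤
      ∫ x, a n x * logIncr w m Z n x ∂P := by
  set θ := hardThreshold w m with hθ
  have i1 : Integrable (noiseEst w m Z n) P :=
    (h.memLp_noiseEst w m n 1).integrable (by simp)
  have i2 := h.integrable_noiseEst_sub_sq w m θ n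
  have j1 := ha.integrable_mul n i1
  have m1 : Measurable[ℱ n] fun x => a n x * noiseEst w m Z n x :=
    (ha.meas n).mul (h.measurable_noiseEst w m n)
  have e := h.integral_mul m1 (g := fun z => z) (by fun_prop)
  rw [integral_id_gaussianReal, mul_zero] at e
  have je := h.integrable_mul m1 j1 (g := fun z => z) (by fun_prop)
    (by simpa using integrable_pow_gaussianReal 1)
  have i0 := ha.integrable (P := P) n
  have i2' := ha.integrable_mul n i2
  calc _ = ∫ x, (a n x * (θ ^ 2 / 2) - a n x * (noiseEst w m Z n x - θ) ^ 2 / 2) +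
        a n x * noiseEst w m Z n x * Z n x ∂P := by
        rw [integral_add (by fun_prop) je, e, add_zero,
          integral_sub (i0.mul_const _) (i2'.div_const _), integral_mul_const, integral_div]
    _ ≤ _ := by
        refine integral_mono (((i0.mul_const _).sub (i2'.div_const _)).add je)
          (ha.integrable_mul n (h.integrable_logIncr w m n)) fun x => ?_
        have h0 := ha.nonneg n x
        have h1 : 0 ≤ noiseEst w m Z n x := hardThreshold_nonneg hw.le _
        -- A mean below its threshold may be replaced by `θ = 0`, since the estimate is nonnegative.
        -- Completing the square then leaves `θ ^ 2 / 2` minus half the squared error.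
        have h2 : noiseEst w m Z n x * θ ≤ noiseEst w m Z n x * m := by
          refine mul_le_mul_of_nonneg_left ?_ h1
          rw [hθ, hardThreshold]; split_ifs <;> simp [hm]
        have := mul_le_mul_of_nonneg_left h2 h0
        simp only [logIncr]
        nlinarith

/-- This turns the squared overshoot term into the accumulated estimation error, which is already
under control. -/
theorem GaussianNoise.integral_mul_sq_mul_sq (h : GaussianNoise P ℱ Z) (ha : StopWeight ℱ a)
    (w m θ : ℝ) (n : ℕ) :
    Integrable (fun x => a n x * (noiseEst w m Z n x - θ) ^ 2 * Z n x ^ 2) P ∧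
    ∫ x, a n x * (noiseEst w m Z n x - θ) ^ 2 * Z n x ^ 2 ∂P =
      ∫ x, a n x * (noiseEst w m Z n x - θ) ^ 2 ∂P := by
  have m1 : Measurable[ℱ n] fun x => a n x * (noiseEst w m Z n x - θ) ^ 2 :=
    (ha.meas n).mul (((h.measurable_noiseEst w m n).sub_const θ).pow_const 2)
  refine ⟨h.integrable_mul m1 (ha.integrable_mul n (h.integrable_noiseEst_sub_sq w m θ n))
    (g := fun z => z ^ 2) (by fun_prop) (integrable_pow_gaussianReal 2), ?_⟩
  rw [h.integral_mul m1 (g := fun z => z ^ 2) (by fun_prop), integral_sq_gaussianReal, mul_one]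

/-- The overshoot of one stream at the stopping time has an integrable majorant, with a mean that
grows slowly with the expected stopping time `t`. -/
theorem GaussianNoise.exists_logIncr_majorant (h : GaussianNoise P ℱ Z) (ha : StopWeight ℱ a)
    (w m θ : ℝ) {c η t : ℝ} (hc : 0 < c) (hη : 0 < η) (ht : 0 < t) (M : ℕ)
    (hM : ∑ l ∈ Finset.range M, ∫ x, a l x ∂P = t) :
    ∃ G : Ω → ℝ, Integrable G P ∧
      (∀ x, ∀ l < M, a l x = 1 → logIncr w m Z l x ≤ G x) ∧
      ∫ x, G x ∂P = |θ| * ((Real.log t + ∫ z, Real.exp (c * |z|) ∂(gaussianReal 0 1)) / c) +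
        η * (∑ l ∈ Finset.range M, ∫ x, a l x * (noiseEst w m Z l x - θ) ^ 2 ∂P) +
        (1 / (4 * η) + m ^ 2 / 2) := by
  have hme : Measurable fun z : ℝ => Real.exp (c * |z|) := by fun_prop
  have iE (l : ℕ) := h.integrable_mul (ha.meas l) (ha.integrable l) hme
    (integrable_exp_abs_gaussianReal c)
  have eE (l : ℕ) := h.integral_mul (ha.meas l) hme
  have iV (l : ℕ) := (h.integral_mul_sq_mul_sq ha w m θ l).1
  have eV (l : ℕ) := (h.integral_mul_sq_mul_sq ha w m θ l).2
  have isE : Integrable (fun x => ∑ l ∈ Finset.range M, a l x * Real.exp (c * |Z l x|)) P :=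
    integrable_finsetSum _ fun l _ => iE l
  have isV : Integrable (fun x => ∑ l ∈ Finset.range M,
      a l x * (noiseEst w m Z l x - θ) ^ 2 * Z l x ^ 2) P :=
    integrable_finsetSum _ fun l _ => iV l
  have iA : Integrable (fun x => |θ| * ((Real.log t +
      (∑ l ∈ Finset.range M, a l x * Real.exp (c * |Z l x|)) / t) / c)) P :=
    (((integrable_const _).add (isE.div_const t)).div_const c).const_mul _
  have iB : Integrable (fun x => η * ∑ l ∈ Finset.range M,
      a l x * (noiseEst w m Z l x - θ) ^ 2 * Z l x ^ 2) P := isV.const_mul η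
  refine ⟨fun x => |θ| * ((Real.log t +
      (∑ l ∈ Finset.range M, a l x * Real.exp (c * |Z l x|)) / t) / c) +
    η * (∑ l ∈ Finset.range M, a l x * (noiseEst w m Z l x - θ) ^ 2 * Z l x ^ 2) +
    (1 / (4 * η) + m ^ 2 / 2), (iA.add iB).add (integrable_const _), fun x l hl hal => ?_, ?_⟩
  · have h1 : Real.exp (c * |Z l x|) ≤ ∑ l ∈ Finset.range M, a l x * Real.exp (c * |Z l x|) := by
      have := Finset.single_le_sum (f := fun l => a l x * Real.exp (c * |Z l x|))
        (fun i _ => mul_nonneg (ha.nonneg i x) (Real.exp_pos _).le) (Finset.mem_range.2 hl)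
      simpa [hal] using this
    have h2 : (noiseEst w m Z l x - θ) ^ 2 * Z l x ^ 2 ≤
        ∑ l ∈ Finset.range M, a l x * (noiseEst w m Z l x - θ) ^ 2 * Z l x ^ 2 := by
      have := Finset.single_le_sum
        (f := fun l => a l x * (noiseEst w m Z l x - θ) ^ 2 * Z l x ^ 2)
        (fun i _ => mul_nonneg (mul_nonneg (ha.nonneg i x) (sq_nonneg _)) (sq_nonneg _))
        (Finset.mem_range.2 hl)
      simpa [hal] using this
    -- The tangent line of `log` at `t`, applied to `exp (c * |Z|)`. Summed over the running times,
    -- the exponentials have mean `t` times a constant, whence `(log t + const) / c` with `c` at our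
    -- disposal.
    have h3 : |Z l x| ≤ (Real.log t +
        (∑ l ∈ Finset.range M, a l x * Real.exp (c * |Z l x|)) / t) / c := by
      rw [le_div_iff₀ hc]
      have := Real.log_le_sub_one_of_pos (div_pos (Real.exp_pos (c * |Z l x|)) ht)
      rw [Real.log_div (Real.exp_pos _).ne' ht.ne', Real.log_exp] at this
      have : Real.exp (c * |Z l x|) / t ≤
        (∑ l ∈ Finset.range M, a l x * Real.exp (c * |Z l x|)) / t := by gcongr
      linarith
    have h4 : (noiseEst w m Z l x - θ) * Z l x ≤
        η * ((noiseEst w m Z l x - θ) ^ 2 * Z l x ^ 2) + 1 / (4 * η) := by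
      have : η * ((noiseEst w m Z l x - θ) ^ 2 * Z l x ^ 2) + 1 / (4 * η) -
        (noiseEst w m Z l x - θ) * Z l x =
          (2 * η * ((noiseEst w m Z l x - θ) * Z l x) - 1) ^ 2 / (4 * η) := by
        field_simp; ring
      have : 0 ≤ (2 * η * ((noiseEst w m Z l x - θ) * Z l x) - 1) ^ 2 / (4 * η) := by positivity
      linarith
    have h5 := mul_le_mul_of_nonneg_left h2 hη.le
    have h6 := mul_le_mul_of_nonneg_left h3 (abs_nonneg θ)
    have h7 := logIncr_le w m θ Z l x
    linarith
  · rw [integral_add (by fun_prop) (integrable_const _), integral_add iA iB, integral_const_mul,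
      integral_const_mul, integral_div, integral_add (integrable_const _) (isE.div_const t),
      integral_div, integral_finsetSum _ fun l _ => iE l, integral_finsetSum _ fun l _ => iV l]
    simp_rw [eE, eV]
    rw [← Finset.sum_mul, hM, mul_div_cancel_left₀ _ ht.ne']
    simp

/-- A Wald-type bound for the expected (truncated) duration `t` of an observation that is stopped as
soon as the plug-in log-likelihood ratio has reached the level `b`. -/
theorem exists_wald_bound {p : ℕ} {Z : Fin p → ℕ → Ω → ℝ} (h : ∀ k, GaussianNoise P ℱ (Z k))
    {ω μ : Fin p → ℝ} (hω : ∀ k, 0 < ω k) (hμ : ∀ k, 0 ≤ μ k) (hne : ∀ k, μ k ≠ ω k)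
    {δ : ℝ} (hδ : 0 < δ) :
    ∃ C : ℝ, ∀ (b : ℝ) (a : ℕ → Ω → ℝ), StopWeight ℱ a → (∀ x, a 0 x = 1) → ∀ M, 1 ≤ M →
      (∀ x, ∃ l < M, a l x = 1 ∧
        ∑ i ∈ Finset.range M, a i x * ∑ k, logIncr (ω k) (μ k) (Z k) i x ≤
          b + ∑ k, logIncr (ω k) (μ k) (Z k) l x) →
      info ω μ * (∑ l ∈ Finset.range M, ∫ x, a l x ∂P) ≤
        b + (((exceedSet ω μ).card : ℝ) / 2 + δ) *
          Real.log (∑ l ∈ Finset.range M, ∫ x, a l x ∂P) + C := by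
  choose K hK0 hK using fun k => (h k).sum_integral_noiseEst_sub_sq_le (hω k) (hμ k) (hne k)
  set θ : Fin p → ℝ := fun k => hardThreshold (ω k) (μ k) with hθ
  set r : ℝ := ((exceedSet ω μ).card : ℝ) with hr
  have hr0 : 0 ≤ r := Nat.cast_nonneg _
  have hrι : ∑ k, (if ω k ≤ μ k then (1 : ℝ) else 0) = r := by
    rw [hr, exceedSet, Finset.sum_boole]
  set A := ∑ k, |θ k|
  have hA : 0 ≤ A := Finset.sum_nonneg fun k _ => abs_nonneg _
  -- `η` and `c` are chosen so that the error part and the `|θ| * |Z|` part of the overshoot each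
  -- cost at most `δ / 2 * log t`.
  set η := δ / (2 * (r + 1)) with hηd
  have hη : 0 < η := by positivity
  set c := 2 * (A + 1) / δ with hcd
  have hc : 0 < c := by positivity
  have hinfo : info ω μ = ∑ k, θ k ^ 2 / 2 := by
    rw [info, exceedSet, Finset.sum_filter, Finset.mul_sum]
    refine Finset.sum_congr rfl fun k _ => ?_
    simp only [hθ, hardThreshold]; split_ifs <;> ring
  set E := ∫ z, Real.exp (c * |z|) ∂(gaussianReal 0 1)
  refine ⟨(1 / 2 + η) * (3 * r + ∑ k, K k) + (A * (E / c) + ∑ k, (1 / (4 * η) + μ k ^ 2 / 2)),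
    fun b a ha h0 M hM hlast => ?_⟩
  set t := ∑ l ∈ Finset.range M, ∫ x, a l x ∂P with ht
  have hnn (l : ℕ) : 0 ≤ ∫ x, a l x ∂P := integral_nonneg (ha.nonneg l)
  have ht1 : 1 ≤ t := by
    have := Finset.single_le_sum (f := fun l => ∫ x, a l x ∂P) (fun i _ => hnn i)
      (Finset.mem_range.2 hM)
    simpa [h0] using this
  have hlog : 0 ≤ Real.log t := Real.log_nonneg ht1
  set Q : Fin p → ℝ := fun k =>
    ∑ l ∈ Finset.range M, ∫ x, a l x * (noiseEst (ω k) (μ k) (Z k) l x - θ k) ^ 2 ∂P with hQ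
  have hQle : ∑ k, Q k ≤ r * (Real.log t + 3) + ∑ k, K k := by
    rw [← hrι, Finset.sum_mul, ← Finset.sum_add_distrib]
    refine Finset.sum_le_sum fun k _ => (hK k a ha M).trans ?_
    gcongr
    exact sum_div_succ_le_log hnn (fun l => by
      simpa using integral_mono (ha.integrable l) (integrable_const (μ := P) (1 : ℝ))
        (ha.le_one l)) M ht1
  have iY (i : ℕ) (k : Fin p) := ha.integrable_mul i ((h k).integrable_logIncr (ω k) (μ k) i)
  have hlow : info ω μ * t - (∑ k, Q k) / 2 ≤
      ∫ x, ∑ i ∈ Finset.range M, a i x * ∑ k, logIncr (ω k) (μ k) (Z k) i x ∂P := by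
    simp_rw [Finset.mul_sum]
    rw [integral_finsetSum _ fun i _ => integrable_finsetSum _ fun k _ => iY i k]
    simp_rw [integral_finsetSum _ fun k _ => iY _ k]
    rw [Finset.sum_comm (s := Finset.range M) (f := fun i k =>
      ∫ x, a i x * logIncr (ω k) (μ k) (Z k) i x ∂P), hinfo, Finset.sum_mul, Finset.sum_div,
      ← Finset.sum_sub_distrib]
    refine Finset.sum_le_sum fun k _ => ?_
    rw [ht, hQ, Finset.mul_sum, Finset.sum_div, ← Finset.sum_sub_distrib]
    refine Finset.sum_le_sum fun i _ => ?_
    rw [mul_comm]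
    exact (h k).le_integral_mul_logIncr ha (hω k) (hμ k) i
  choose G iG hG eG using fun k => (h k).exists_logIncr_majorant ha (ω k) (μ k) (θ k) hc hη
    (by linarith : 0 < t) M ht.symm
  have hup : ∫ x, ∑ i ∈ Finset.range M, a i x * ∑ k, logIncr (ω k) (μ k) (Z k) i x ∂P ≤
      b + ∑ k, ∫ x, G k x ∂P := by
    have isG : Integrable (fun x => ∑ k, G k x) P := integrable_finsetSum _ fun k _ => iG k
    calc _ ≤ ∫ x, b + ∑ k, G k x ∂P := by
          refine integral_mono (integrable_finsetSum _ fun i _ => ?_)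
            ((integrable_const _).add isG) fun x => ?_
          · simp_rw [Finset.mul_sum]
            exact integrable_finsetSum _ fun k _ => iY i k
          · obtain ⟨l, hl, hal, hb⟩ := hlast x
            exact hb.trans (add_le_add_right (Finset.sum_le_sum fun k _ => hG k x l hl hal) _)
      _ = _ := by
          rw [integral_add (integrable_const _) isG, integral_finsetSum _ fun k _ => iG k]
          simp
  have hsG : ∑ k, ∫ x, G k x ∂P = A * ((Real.log t + E) / c) + η * ∑ k, Q k +
      ∑ k, (1 / (4 * η) + μ k ^ 2 / 2) := by
    simp_rw [eG]
    rw [Finset.sum_add_distrib, Finset.sum_add_distrib, ← Finset.sum_mul, ← Finset.mul_sum]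
  have hηr : η * r ≤ δ / 2 := by
    rw [hηd, div_mul_eq_mul_div, div_le_div_iff₀ (by positivity) (by positivity)]
    nlinarith
  have hAc : A / c ≤ δ / 2 := by
    rw [hcd, div_div_eq_mul_div, div_le_div_iff₀ (by positivity) (by positivity)]
    nlinarith
  have f1 := mul_le_mul_of_nonneg_right hηr hlog
  have f2 := mul_le_mul_of_nonneg_right hAc hlog
  have f3 := mul_le_mul_of_nonneg_left hQle (by positivity : 0 ≤ 1 / 2 + η)
  have f4 : A * ((Real.log t + E) / c) = A / c * Real.log t + A * (E / c) := by ring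
  rw [hsG, f4] at hup
  nlinarith

end Noise

/-! ### The stream law and the plug-in ratio started at time zero. -/

variable {p : ℕ}

/-- The filtration of the strict past: at time `n`, the observations at times `0, …, n - 1`. -/
def pastFiltration (p : ℕ) : Filtration ℕ (inferInstance : MeasurableSpace (Path p)) where
  seq n := ⨆ i ∈ Set.Iio n, MeasurableSpace.comap (fun x : Path p => x i) inferInstance
  mono' _ _ h := biSup_mono fun _ hi => lt_of_lt_of_le hi h
  le' _ := iSup₂_le fun i _ => (measurable_pi_apply i).comap_le

theorem measurable_pastFiltration {i n : ℕ} (h : i < n) :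
    Measurable[pastFiltration p n] fun x : Path p => x i :=
  Measurable.of_comap_le
    (le_iSup₂_of_le (f := fun i (_ : i ∈ Set.Iio n) =>
      MeasurableSpace.comap (fun x : Path p => x i) inferInstance) i h le_rfl)

theorem measurable_pastFiltration_apply {i n : ℕ} (h : i < n) (k : Fin p) :
    Measurable[pastFiltration p n] fun x : Path p => x i k :=
  (measurable_pi_apply k).comp (measurable_pastFiltration h)

theorem iIndep_streamLaw (mean : ℕ → Fin p → ℝ) :
    iIndep (fun i => MeasurableSpace.comap (fun x : Path p => x i) inferInstance)
      (streamLaw mean) :=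
  iIndepFun_infinitePi (X := fun _ y => y) fun _ => measurable_id

theorem indep_pastFiltration (mean : ℕ → Fin p → ℝ) (n : ℕ) :
    Indep (pastFiltration p n) (MeasurableSpace.comap (fun x : Path p => x n) inferInstance)
      (streamLaw mean) := by
  have := indep_iSup_of_disjoint (fun i => (measurable_pi_apply i).comap_le)
    (iIndep_streamLaw mean) (S := Set.Iio n) (T := {n}) (by simp)
  simp only [Set.mem_singleton_iff, iSup_iSup_eq_left] at this
  exact this

theorem streamLaw_map_eval (mean : ℕ → Fin p → ℝ) (n : ℕ) :
    (streamLaw mean).map (fun x => x n) = Measure.pi fun k => gaussianReal (mean n k) 1 :=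
  Measure.infinitePi_map_eval _ n

theorem gaussianNoise_streamLaw (μ : Fin p → ℝ) (k : Fin p) :
    GaussianNoise (streamLaw fun _ => μ) (pastFiltration p) fun n x => x n k - μ k where
  meas n := (measurable_pastFiltration_apply (Nat.lt_succ_self n) k).sub_const _
  law n := by
    have h1 : (streamLaw fun _ => μ).map (fun x => x n k) = gaussianReal (μ k) 1 := by
      rw [← (measurePreserving_eval (fun k => gaussianReal (μ k) 1) k).map_eq,
        ← streamLaw_map_eval (fun _ => μ) n,
        Measure.map_map (measurable_pi_apply k) (measurable_pi_apply n)]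
      rfl
    have : (fun x : Path p => x n k - μ k) = (fun y => y - μ k) ∘ fun x => x n k := rfl
    rw [this, ← Measure.map_map (by fun_prop) (by fun_prop), h1, gaussianReal_map_sub_const,
      sub_self]
  indep n := by
    refine indep_of_indep_of_le_right (indep_pastFiltration _ n) ?_
    exact measurable_iff_comap_le.1
      (((measurable_pi_apply k).comp (Measurable.of_comap_le le_rfl)).sub_const _)

theorem gaussianPDFReal_div_gaussianPDFReal (h y : ℝ) :
    gaussianPDFReal h 1 y / gaussianPDFReal 0 1 y = Real.exp (h * y - h ^ 2 / 2) := by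
  simp only [gaussianPDFReal]
  rw [mul_div_mul_left _ _ (by positivity), ← Real.exp_sub]
  congr 1; simp; ring

theorem likelihoodRatio_eq_exp (ω : Fin p → ℝ) (n m : ℕ) (x : Path p) :
    likelihoodRatio ω n m x = Real.exp (∑ l ∈ Finset.Icc m n, ∑ k,
      (muHat ω k m l x * x l k - muHat ω k m l x ^ 2 / 2)) := by
  simp_rw [likelihoodRatio, gaussianPDFReal_div_gaussianPDFReal, Real.exp_sum]

theorem likelihoodRatio_pos (ω : Fin p → ℝ) (n m : ℕ) (x : Path p) :
    0 < likelihoodRatio ω n m x := by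
  rw [likelihoodRatio_eq_exp]; exact Real.exp_pos _

theorem measurable_muHat (ω : Fin p → ℝ) (k : Fin p) (m l : ℕ) :
    Measurable[pastFiltration p l] (muHat ω k m l) := by
  have : Measurable[pastFiltration p l] (sampleMean (p := p) k m l) := by
    unfold sampleMean
    refine Measurable.div_const (Finset.measurable_fun_sum _ fun i hi => ?_) _
    exact measurable_pastFiltration_apply (Finset.mem_Ico.1 hi).2 k
  exact (measurable_hardThreshold (ω k)).comp this

theorem measurable_likelihoodRatio (ω : Fin p → ℝ) (n m : ℕ) :
    Measurable[pastFiltration p (n + 1)] (likelihoodRatio ω n m) := by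
  rw [funext (likelihoodRatio_eq_exp ω n m)]
  refine Real.measurable_exp.comp (Finset.measurable_fun_sum _ fun l hl =>
    Finset.measurable_fun_sum _ fun k _ => ?_)
  have hl' : l < n + 1 := Nat.lt_succ_of_le (Finset.mem_Icc.1 hl).2
  have hm := (measurable_muHat ω k m l).mono ((pastFiltration p).mono hl'.le) le_rfl
  exact (hm.mul (measurable_pastFiltration_apply hl' k)).sub ((hm.pow_const 2).div_const 2)

theorem muHat_zero_eq_noiseEst (ω μ : Fin p → ℝ) (k : Fin p) (l : ℕ) (x : Path p) :
    muHat ω k 0 l x = noiseEst (ω k) (μ k) (fun n x => x n k - μ k) l x := by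
  have : sampleMean k 0 l x = (l * μ k + noiseSum (fun n x => x n k - μ k) l x) / l := by
    simp [sampleMean, noiseSum]
  rw [muHat, noiseEst, hardThreshold, this]

theorem likelihoodRatio_zero_eq_exp (ω μ : Fin p → ℝ) (n : ℕ) (x : Path p) :
    likelihoodRatio ω n 0 x = Real.exp (∑ l ∈ Finset.range (n + 1), ∑ k,
      logIncr (ω k) (μ k) (fun n x => x n k - μ k) l x) := by
  rw [likelihoodRatio_eq_exp, Finset.range_eq_Ico, Finset.Ico_add_one_right_eq_Icc]
  simp only [muHat_zero_eq_noiseEst ω μ, logIncr, add_sub_cancel]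

/-- The indicator that the plug-in likelihood ratio of a change at time `0` has not reached the
level `B` before time `l`. -/
def notReached (ω : Fin p → ℝ) (B : ℝ) (l : ℕ) (x : Path p) : ℝ :=
  open scoped Classical in if ∀ n < l, likelihoodRatio ω n 0 x < B then 1 else 0

theorem stopWeight_notReached (ω : Fin p → ℝ) (B : ℝ) :
    StopWeight (pastFiltration p) (notReached ω B) where
  meas l := by
    classical
    refine Measurable.ite ?_ measurable_const measurable_const
    simp only [Set.ofPred_forall]
    refine MeasurableSet.iInter fun n => MeasurableSet.iInter fun hn => ?_
    exact (measurable_likelihoodRatio ω n 0).mono ((pastFiltration p).mono hn) le_rfl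
      measurableSet_Iio
  nonneg l x := by unfold notReached; split_ifs <;> norm_num
  le_one l x := by unfold notReached; split_ifs <;> norm_num
  anti l x := by
    unfold notReached
    split_ifs with h1 h2 h2
    · exact le_rfl
    · exact absurd (fun n hn => h1 n (by lia)) h2
    · exact zero_le_one
    · exact le_rfl

theorem notReached_zero (ω : Fin p → ℝ) (B : ℝ) (x : Path p) : notReached ω B 0 x = 1 := by
  simp [notReached]

/-- Before the level `B` is reached for the first time, the log-likelihood ratio is below
`log B`, up to the last increment. -/
theorem exists_last_notReached (ω μ : Fin p → ℝ) {B : ℝ} (hB : 1 ≤ B) {M : ℕ} (hM : 1 ≤ M)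
    (x : Path p) :
    ∃ l < M, notReached ω B l x = 1 ∧
      ∑ i ∈ Finset.range M, notReached ω B i x *
          ∑ k, logIncr (ω k) (μ k) (fun n x => x n k - μ k) i x ≤
        Real.log B + ∑ k, logIncr (ω k) (μ k) (fun n x => x n k - μ k) l x := by
  induction M, hM using Nat.le_induction with
  | base => exact ⟨0, one_pos, notReached_zero .., by
      simpa [notReached_zero] using Real.log_nonneg hB⟩
  | succ M hM ih =>
    by_cases h : ∀ n < M, likelihoodRatio ω n 0 x < B
    · refine ⟨M, Nat.lt_succ_self M, if_pos h, ?_⟩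
      have h1 : ∀ i ∈ Finset.range M, notReached ω B i x = 1 := fun i hi =>
        if_pos fun n hn => h n (hn.trans (Finset.mem_range.1 hi))
      rw [Finset.sum_range_succ, show notReached ω B M x = 1 from if_pos h, one_mul,
        Finset.sum_congr rfl fun i hi => by rw [h1 i hi, one_mul]]
      gcongr
      -- Still running at time `M` means that the ratio through time `M - 1` is below `B`; only the
      -- increment at `M` is left over.
      have := (h (M - 1) (by lia)).le
      rw [likelihoodRatio_zero_eq_exp ω μ, Nat.sub_add_cancel hM] at this
      exact (Real.le_log_iff_exp_le (by linarith)).2 this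
    · obtain ⟨l, hl, h1, h2⟩ := ih
      refine ⟨l, by lia, h1, ?_⟩
      rw [Finset.sum_range_succ, show notReached ω B M x = 0 from if_neg h, zero_mul, add_zero]
      exact h2

/-! ### Reduction of the worst-case delay to the expected duration. -/

/-- The number of observations needed, from the change on, by the plug-in likelihood ratio that
starts at the change to reach the level `B`. -/
def duration (ω : Fin p → ℝ) (B : ℝ) (x : Path p) : ℝ≥0∞ :=
  ∑' l, ENNReal.ofReal (notReached ω B l x)

theorem measurable_duration (ω : Fin p → ℝ) (B : ℝ) : Measurable (duration ω B) :=
  Measurable.tsum fun l => ((stopWeight_notReached ω B).measurable l).ennreal_ofReal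

theorem lintegral_duration_le (ω μ : Fin p → ℝ) {B c : ℝ}
    (h : ∀ M, 1 ≤ M →
      ∑ l ∈ Finset.range M, ∫ x, notReached ω B l x ∂(streamLaw fun _ => μ) ≤ c) :
    ∫⁻ x, duration ω B x ∂(streamLaw fun _ => μ) ≤ ENNReal.ofReal c := by
  have ha := stopWeight_notReached ω B
  unfold duration
  rw [lintegral_tsum fun l => (ha.measurable l).ennreal_ofReal.aemeasurable]
  simp_rw [← ofReal_integral_eq_lintegral_ofReal (ha.integrable _) (ae_of_all _ (ha.nonneg _))]
  refine ENNReal.tsum_le_of_sum_range_le fun M => ?_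
  rw [← ENNReal.ofReal_sum_of_nonneg fun l _ => integral_nonneg (ha.nonneg l)]
  refine ENNReal.ofReal_le_ofReal (le_trans ?_ (h (M + 1) (by lia)))
  rw [Finset.sum_range_succ]
  exact le_add_of_nonneg_right (integral_nonneg (ha.nonneg M))

/-- The path seen from time `ν` on. -/
def shift (ν : ℕ) (x : Path p) : Path p := fun i => x (i + ν)

theorem measurable_shift (ν : ℕ) : Measurable (shift (p := p) ν) :=
  measurable_pi_lambda _ fun _ => measurable_pi_apply _

theorem lawChangeAt_map_shift (μ : Fin p → ℝ) (ν : ℕ) :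
    (lawChangeAt μ ν).map (shift ν) = streamLaw fun _ => μ := by
  have := Measure.map_infinitePi_infinitePi_of_inj
    (P := fun ℓ : ℕ => Measure.pi fun k : Fin p => gaussianReal (if ν ≤ ℓ then μ k else 0) 1)
    (add_left_injective ν)
  simp only [Nat.le_add_left, if_true] at this
  exact this

theorem indep_pastOf_shift (mean : ℕ → Fin p → ℝ) (ν : ℕ) :
    Indep (pastOf p ν) (MeasurableSpace.comap (shift ν) inferInstance) (streamLaw mean) := by
  refine indep_of_indep_of_le_left (indep_of_indep_of_le_right
    (indep_iSup_of_disjoint (fun i => (measurable_pi_apply i).comap_le)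
    (iIndep_streamLaw mean) (S := Set.Iio ν) (T := Set.Ici ν) ?_) ?_) ?_
  · exact Set.disjoint_left.2 fun i h1 h2 => (Set.mem_Iio.1 h1).not_ge (Set.mem_Ici.1 h2)
  · refine measurable_iff_comap_le.1 (@measurable_pi_lambda _ _ _ (_) _ _ fun i => ?_)
    exact Measurable.of_comap_le (le_iSup₂_of_le (f := fun i (_ : i ∈ Set.Ici ν) =>
      MeasurableSpace.comap (fun x : Path p => x i) inferInstance) (i + ν)
      (Nat.le_add_left _ _) le_rfl)
  · exact biSup_mono fun i hi => (Finset.mem_Ico.1 hi).2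

theorem sampleMean_add (k : Fin p) (ν m l : ℕ) (x : Path p) :
    sampleMean k (m + ν) (l + ν) x = sampleMean k m l (shift ν x) := by
  simp only [sampleMean, shift]
  rw [← Finset.sum_Ico_add' (fun i => x i k)]
  push_cast; congr 1; ring

theorem likelihoodRatio_add (ω : Fin p → ℝ) (ν n m : ℕ) (x : Path p) :
    likelihoodRatio ω (n + ν) (m + ν) x = likelihoodRatio ω n m (shift ν x) := by
  simp only [likelihoodRatio, ← Finset.Ico_add_one_right_eq_Icc]
  rw [show n + ν + 1 = n + 1 + ν by ring, ← Finset.prod_Ico_add']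
  simp only [muHat, sampleMean_add]
  rfl

theorem alarmTime_le (ω : Fin p → ℝ) {B : ℝ} {m n : ℕ} (hm : 1 ≤ m) (hmn : m ≤ n) {x : Path p}
    (h : B ≤ likelihoodRatio ω n m x) : alarmTime ω B x ≤ n := by
  refine hittingAfter_le_of_mem (hm.trans hmn) (h.trans ?_)
  exact Finset.single_le_sum (f := fun m => likelihoodRatio ω n m x)
    (fun i _ => (likelihoodRatio_pos ω n i x).le) (Finset.mem_Icc.2 ⟨hm, hmn⟩)

/-- The summand `m = ν` alone triggers the alarm once it reaches `B`. The bound holds on every path,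
also where the subtraction truncates. -/
theorem alarmTime_sub_le_duration (ω : Fin p → ℝ) (B : ℝ) {ν : ℕ} (hν : 1 ≤ ν) (x : Path p) :
    (alarmTime ω B x : ℝ≥0∞) + 1 - ν ≤ duration ω B (shift ν x) := by
  classical
  by_cases h : ∃ n, B ≤ likelihoodRatio ω n 0 (shift ν x)
  · have h1 := Nat.find_spec h
    have h2 : ∀ n < Nat.find h, likelihoodRatio ω n 0 (shift ν x) < B := fun n hn =>
      not_le.1 (Nat.find_min h hn)
    set n := Nat.find h
    rw [← likelihoodRatio_add, zero_add] at h1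
    have h3 : (alarmTime ω B x : ℝ≥0∞) ≤ ((n + ν : ℕ) : ℝ≥0∞) := by
      have := alarmTime_le ω hν (Nat.le_add_left ν n) h1
      exact_mod_cast ENat.toENNReal_le.2 this
    calc (alarmTime ω B x : ℝ≥0∞) + 1 - ν ≤ ((n + ν : ℕ) : ℝ≥0∞) + 1 - ν := by gcongr
      _ = ((n + 1 : ℕ) : ℝ≥0∞) := by
          push_cast
          rw [add_right_comm, ENNReal.add_sub_cancel_right (by simp)]
      _ = ∑ l ∈ Finset.range (n + 1), ENNReal.ofReal (notReached ω B l (shift ν x)) := by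
          rw [Finset.sum_congr rfl fun l hl => by
            rw [notReached, if_pos fun i hi => h2 i (hi.trans_le (Finset.mem_range_succ_iff.1 hl))]]
          simp
      _ ≤ _ := ENNReal.sum_le_tsum _
  · push Not at h
    have : duration ω B (shift ν x) = ⊤ := by
      have : ∀ l, notReached ω B l (shift ν x) = 1 := fun l => if_pos fun n _ => h n
      simp [duration, this]
    rw [this]; exact le_top

/-- The path from `ν` on is independent of the observations before `ν`, so conditioning on them has
no effect. -/
theorem condLExp_comp_shift (μ : Fin p → ℝ) (ν : ℕ) {g : Path p → ℝ≥0∞} (hg : Measurable g) :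
    condLExp (pastOf p ν) (lawChangeAt μ ν) (fun x => g (shift ν x)) =ᵐ[lawChangeAt μ ν]
      fun _ => ∫⁻ x, g x ∂(streamLaw fun _ => μ) := by
  have : IsProbabilityMeasure (lawChangeAt μ ν) := by unfold lawChangeAt; infer_instance
  refine (ae_eq_condLExp (pastOf_le p ν) _ _ measurable_const fun s hs => ?_).symm
  rw [setLIntegral_const, ← lawChangeAt_map_shift μ ν, lintegral_map hg (measurable_shift ν),
    ← lintegral_indicator (pastOf_le p ν s hs)]
  have h := lintegral_mul_eq_lintegral_mul_lintegral_of_independent_measurableSpace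
    (pastOf_le p ν) (measurable_shift ν).comap_le (indep_pastOf_shift _ ν :
      Indep (pastOf p ν) (MeasurableSpace.comap (shift ν) inferInstance) (lawChangeAt μ ν))
    (Measurable.indicator (m := pastOf p ν) (f := fun _ => (1 : ℝ≥0∞)) measurable_const hs)
    (hg.comp (Measurable.of_comap_le le_rfl) :
      Measurable[MeasurableSpace.comap (shift ν) inferInstance] fun x => g (shift ν x))
  change ∫⁻ x, s.indicator (1 : Path p → ℝ≥0∞) x * g (shift ν x) ∂(lawChangeAt μ ν) =
    (∫⁻ x, s.indicator 1 x ∂(lawChangeAt μ ν)) * ∫⁻ x, g (shift ν x) ∂(lawChangeAt μ ν) at h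
  rw [lintegral_indicator_one (pastOf_le p ν s hs)] at h
  rw [mul_comm, ← h]
  refine lintegral_congr fun x => ?_
  by_cases hx : x ∈ s <;> simp [hx]

theorem detectionDelay_le (ω μ : Fin p → ℝ) (B : ℝ) :
    detectionDelay μ (alarmTime ω B) ≤ ∫⁻ x, duration ω B x ∂(streamLaw fun _ => μ) := by
  refine iSup₂_le fun ν hν => essSup_le_of_ae_le _ (ae_restrict_of_ae ?_)
  filter_upwards [condLExp_comp_shift μ ν (measurable_duration ω B),
    condLExp_mono (mΩ := pastOf p ν) (P := lawChangeAt μ ν)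
      (ae_of_all _ fun x => alarmTime_sub_le_duration ω B hν x)] with x h1 h2
  exact h2.trans h1.le

/-! ### Average run length to false alarm. -/

theorem integrable_exp_tilt (h : ℝ) :
    Integrable (fun y => Real.exp (h * y - h ^ 2 / 2)) (gaussianReal 0 1) := by
  simp_rw [Real.exp_sub]
  exact (integrable_exp_mul_gaussianReal h).div_const _

theorem integral_exp_tilt (h : ℝ) :
    ∫ y, Real.exp (h * y - h ^ 2 / 2) ∂(gaussianReal 0 1) = 1 := by
  have := congrFun (mgf_id_gaussianReal (μ := 0) (v := 1)) h
  simp only [mgf, id] at this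
  simp_rw [Real.exp_sub]
  rw [integral_div, this, ← Real.exp_sub]
  simp

theorem lintegral_exp_sum_tilt (h : Fin p → ℝ) :
    ∫⁻ y : Fin p → ℝ, ENNReal.ofReal (Real.exp (∑ k, (h k * y k - h k ^ 2 / 2)))
      ∂(Measure.pi fun _ => gaussianReal 0 1) = 1 := by
  simp_rw [Real.exp_sum]
  rw [← ofReal_integral_eq_lintegral_ofReal
    (Integrable.fintype_prod (f := fun k y => Real.exp (h k * y - h k ^ 2 / 2))
      fun k => integrable_exp_tilt (h k))
    (ae_of_all _ fun y => Finset.prod_nonneg fun k _ => (Real.exp_pos _).le),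
    integral_fintype_prod_eq_prod (fun k y => Real.exp (h k * y - h k ^ 2 / 2))]
  simp [integral_exp_tilt]

theorem likelihoodRatio_self (ω : Fin p → ℝ) (n : ℕ) (x : Path p) :
    likelihoodRatio ω n n x = 1 := by
  have (k : Fin p) : muHat ω k n n x = 0 := by
    simp [muHat, sampleMean]
  simp [likelihoodRatio_eq_exp, this]

theorem likelihoodRatio_succ (ω : Fin p → ℝ) {n m : ℕ} (h : m ≤ n + 1) (x : Path p) :
    likelihoodRatio ω (n + 1) m x = likelihoodRatio ω n m x * Real.exp (∑ k,
      (muHat ω k m (n + 1) x * x (n + 1) k - muHat ω k m (n + 1) x ^ 2 / 2)) := by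
  rw [likelihoodRatio_eq_exp, likelihoodRatio_eq_exp, ← Real.exp_add,
    Finset.sum_Icc_succ_top h]

/-- Under the law without change, the plug-in likelihood ratios are martingales. -/
theorem lintegral_mul_likelihoodRatio_succ (ω : Fin p → ℝ) {n m : ℕ} (h : m ≤ n + 1)
    {g : Path p → ℝ≥0∞} (hg : Measurable[pastFiltration p (n + 1)] g) :
    ∫⁻ x, g x * ENNReal.ofReal (likelihoodRatio ω (n + 1) m x) ∂(lawNoChange p) =
      ∫⁻ x, g x * ENNReal.ofReal (likelihoodRatio ω n m x) ∂(lawNoChange p) := by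
  have : IsProbabilityMeasure (lawNoChange p) := by unfold lawNoChange; infer_instance
  set H : Path p → ℝ≥0∞ × (Fin p → ℝ) := fun x =>
    (g x * ENNReal.ofReal (likelihoodRatio ω n m x), fun k => muHat ω k m (n + 1) x)
  set φ : (ℝ≥0∞ × (Fin p → ℝ)) × (Fin p → ℝ) → ℝ≥0∞ := fun q =>
    q.1.1 * ENNReal.ofReal (Real.exp (∑ k, (q.1.2 k * q.2 k - q.1.2 k ^ 2 / 2))) with hφ
  have hφm : Measurable φ := by fun_prop
  have hH : Measurable[pastFiltration p (n + 1)] H := by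
    refine Measurable.prodMk
      (hg.mul (ENNReal.measurable_ofReal.comp (measurable_likelihoodRatio ω n m)))
      (@measurable_pi_lambda _ _ _ (_) _ _ fun k => measurable_muHat ω k m (n + 1))
  have hHm : Measurable H := hH.mono ((pastFiltration p).le _) le_rfl
  have hi : IndepFun H (fun x : Path p => x (n + 1)) (lawNoChange p) :=
    indep_of_indep_of_le_left (indep_pastFiltration _ (n + 1)) (measurable_iff_comap_le.1 hH)
  have hl := hi.map_prod_eq_prod_map_map hHm.aemeasurable (measurable_pi_apply _).aemeasurable
  have hev : (lawNoChange p).map (fun x => x (n + 1)) = Measure.pi fun _ => gaussianReal 0 1 :=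
    streamLaw_map_eval _ _
  rw [hev] at hl
  calc _ = ∫⁻ x, φ (H x, x (n + 1)) ∂(lawNoChange p) := by
        refine lintegral_congr fun x => ?_
        rw [likelihoodRatio_succ ω h, ENNReal.ofReal_mul (likelihoodRatio_pos ω n m x).le,
          ← mul_assoc]
    -- The new observation is independent of the past recorded in `H`, so it is integrated first
    -- with the estimates frozen; the exponential tilt has mean one.
    _ = ∫⁻ u, ∫⁻ y, φ (u, y) ∂(Measure.pi fun _ => gaussianReal 0 1) ∂(lawNoChange p).map H := by
        rw [← lintegral_prod _ hφm.aemeasurable, ← hl,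
          lintegral_map hφm (hHm.prodMk (measurable_pi_apply _))]
    _ = ∫⁻ u, u.1 ∂(lawNoChange p).map H := by
        refine lintegral_congr fun u => ?_
        simp only [hφ]
        rw [lintegral_const_mul _ (by fun_prop), lintegral_exp_sum_tilt, mul_one]
    _ = _ := by rw [lintegral_map measurable_fst hHm]

/-- The indicator that there is no alarm before time `n`. -/
def noAlarm (ω : Fin p → ℝ) (B : ℝ) (n : ℕ) (x : Path p) : ℝ≥0∞ :=
  open scoped Classical in if ∀ j ∈ Finset.Ico 1 n, statistic ω j x < B then 1 else 0

theorem measurable_statistic (ω : Fin p → ℝ) (n : ℕ) :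
    Measurable[pastFiltration p (n + 1)] (statistic ω n) :=
  Finset.measurable_fun_sum _ fun m _ => measurable_likelihoodRatio ω n m

theorem measurable_noAlarm (ω : Fin p → ℝ) (B : ℝ) (n : ℕ) :
    Measurable[pastFiltration p n] (noAlarm ω B n) := by
  classical
  refine Measurable.ite ?_ measurable_const measurable_const
  simp only [Set.ofPred_forall]
  refine MeasurableSet.iInter fun j => MeasurableSet.iInter fun hj => ?_
  exact (measurable_statistic ω j).mono ((pastFiltration p).mono (Finset.mem_Ico.1 hj).2) le_rfl
    measurableSet_Iio

/-- The old summands are martingales; the new one, `m = n + 1`, equals `1` and contributes the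
drift. -/
theorem lintegral_mul_statistic_succ (ω : Fin p → ℝ) (n : ℕ)
    {g : Path p → ℝ≥0∞} (hg : Measurable[pastFiltration p (n + 1)] g) :
    ∫⁻ x, g x * ENNReal.ofReal (statistic ω (n + 1) x) ∂(lawNoChange p) =
      ∫⁻ x, g x * ENNReal.ofReal (statistic ω n x) ∂(lawNoChange p) +
        ∫⁻ x, g x ∂(lawNoChange p) := by
  have hgm : Measurable g := hg.mono ((pastFiltration p).le _) le_rfl
  have hLm (n m : ℕ) : Measurable (likelihoodRatio ω n m) :=
    (measurable_likelihoodRatio ω n m).mono ((pastFiltration p).le _) le_rfl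
  have hofs (n : ℕ) (x : Path p) : g x * ENNReal.ofReal (statistic ω n x) =
      ∑ m ∈ Finset.Icc 1 n, g x * ENNReal.ofReal (likelihoodRatio ω n m x) := by
    rw [statistic, ENNReal.ofReal_sum_of_nonneg fun m _ => (likelihoodRatio_pos ω n m x).le,
      Finset.mul_sum]
  simp_rw [hofs]
  rw [lintegral_finsetSum _ fun m _ => by fun_prop, lintegral_finsetSum _ fun m _ => by fun_prop,
    Finset.sum_Icc_succ_top (by lia)]
  congr 1
  · exact Finset.sum_congr rfl fun m hm =>
      lintegral_mul_likelihoodRatio_succ ω (by have := (Finset.mem_Icc.1 hm).2; lia) hg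
  · simp [likelihoodRatio_self]

theorem noAlarm_le (ω : Fin p → ℝ) (B : ℝ) (n : ℕ) (x : Path p) : noAlarm ω B n x ≤ 1 := by
  unfold noAlarm; split_ifs <;> simp

/-- Optional stopping for the statistic minus time. -/
theorem stopped_statistic_le (ω : Fin p → ℝ) (B : ℝ) (n : ℕ) :
    ∫⁻ x, noAlarm ω B (n + 1) x * ENNReal.ofReal (statistic ω (n + 1) x) ∂(lawNoChange p) +
        ENNReal.ofReal B * ∫⁻ x, (1 - noAlarm ω B (n + 1) x) ∂(lawNoChange p) ≤
      ∑ j ∈ Finset.range (n + 1), ∫⁻ x, noAlarm ω B (j + 1) x ∂(lawNoChange p) := by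
  have hm (j : ℕ) : Measurable (noAlarm ω B j) :=
    (measurable_noAlarm ω B j).mono ((pastFiltration p).le _) le_rfl
  have hs (j : ℕ) : Measurable (statistic ω j) :=
    (measurable_statistic ω j).mono ((pastFiltration p).le _) le_rfl
  induction n with
  | zero =>
    have (x : Path p) : noAlarm ω B 1 x = 1 := if_pos (by simp)
    simp [this, statistic, likelihoodRatio_self]
  | succ n ih =>
    rw [Finset.sum_range_succ, lintegral_mul_statistic_succ ω (n + 1)
      (measurable_noAlarm ω B (n + 2)), add_right_comm]
    refine add_le_add_left (le_trans ?_ ih) _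
    rw [← lintegral_const_mul _ (by fun_prop), ← lintegral_const_mul _ (by fun_prop),
      ← lintegral_add_left (by fun_prop), ← lintegral_add_left (by fun_prop)]
    -- Pointwise, the only change occurs when the alarm is raised at `n + 1`: a statistic that is at
    -- least `B` is replaced by `B`.
    refine lintegral_mono fun x => ?_
    by_cases h1 : ∀ j ∈ Finset.Ico 1 (n + 1), statistic ω j x < B
    · have e1 : noAlarm ω B (n + 1) x = 1 := if_pos h1
      by_cases h2 : statistic ω (n + 1) x < B
      · have e2 : noAlarm ω B (n + 1 + 1) x = 1 := if_pos fun j hj => by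
          rcases (Nat.lt_succ_iff_lt_or_eq.1 (Finset.mem_Ico.1 hj).2) with h | h
          · exact h1 j (Finset.mem_Ico.2 ⟨(Finset.mem_Ico.1 hj).1, h⟩)
          · rwa [h]
        simp [e1, e2]
      · have e2 : noAlarm ω B (n + 1 + 1) x = 0 :=
          if_neg fun h => h2 (h _ (Finset.mem_Ico.2 ⟨by lia, by lia⟩))
        simpa [e1, e2] using ENNReal.ofReal_le_ofReal (not_lt.1 h2)
    · have e1 : noAlarm ω B (n + 1) x = 0 := if_neg h1
      have e2 : noAlarm ω B (n + 1 + 1) x = 0 := if_neg fun h => h1 fun j hj =>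
        h j (Finset.mem_Ico.2 ⟨(Finset.mem_Ico.1 hj).1, by have := (Finset.mem_Ico.1 hj).2; lia⟩)
      simp [e1, e2]

theorem tsum_noAlarm_le (ω : Fin p → ℝ) (B : ℝ) (x : Path p) :
    ∑' j, noAlarm ω B (j + 1) x ≤ (alarmTime ω B x : ℝ≥0∞) := by
  classical
  by_cases h : ∃ j, 1 ≤ j ∧ B ≤ statistic ω j x
  · have h1 := Nat.find_spec h
    set n := Nat.find h
    have hn : (n : ℕ∞) ≤ alarmTime ω B x := by
      by_contra hlt
      have hlt := not_le.1 hlt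
      have hmem := hittingAfter_mem_set_of_ne_top (u := statistic ω) (s := Set.Ici B) (n := 1)
        (ω := x) hlt.ne_top
      have hle := le_hittingAfter (u := statistic ω) (s := Set.Ici B) (n := 1) x
      obtain ⟨k, hk⟩ := ENat.ne_top_iff_exists.1 hlt.ne_top
      change (1 : ℕ∞) ≤ alarmTime ω B x at hle
      change statistic ω (WithTop.untopA (alarmTime ω B x)) x ∈ Set.Ici B at hmem
      rw [← hk] at hlt hle hmem
      have hkn : k < n := by exact_mod_cast hlt
      exact Nat.find_min h hkn ⟨by exact_mod_cast hle, hmem⟩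
    calc ∑' j, noAlarm ω B (j + 1) x = ∑ j ∈ Finset.range n, noAlarm ω B (j + 1) x := by
          refine tsum_eq_sum fun j hj => if_neg fun hlt => ?_
          have hj' : n ≤ j := by simpa using hj
          exact not_le.2 (hlt n (Finset.mem_Ico.2 ⟨h1.1, by lia⟩)) h1.2
      _ ≤ ∑ j ∈ Finset.range n, 1 := Finset.sum_le_sum fun j _ => noAlarm_le ω B _ x
      _ = ((n : ℕ∞) : ℝ≥0∞) := by simp
      _ ≤ _ := ENat.toENNReal_le.2 hn
  · push Not at h
    have : alarmTime ω B x = ⊤ :=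
      hittingAfter_eq_top_iff.2 fun j hj hB => absurd hB (not_le.2 (h j hj))
    simp [this]

/-- Either the tail probabilities `q` have infinite sum and the run length is infinite, or they tend
to `0` and the stopped inequality passes to the limit. -/
theorem ofReal_le_runLength (ω : Fin p → ℝ) (B : ℝ) :
    ENNReal.ofReal B ≤ runLength (alarmTime ω B) := by
  have : IsProbabilityMeasure (lawNoChange p) := by unfold lawNoChange; infer_instance
  have hm (j : ℕ) : Measurable (noAlarm ω B j) :=
    (measurable_noAlarm ω B j).mono ((pastFiltration p).le _) le_rfl
  set q : ℕ → ℝ≥0∞ := fun j => ∫⁻ x, noAlarm ω B (j + 1) x ∂(lawNoChange p)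
  have hq : ∑' j, q j ≤ runLength (alarmTime ω B) := by
    rw [← lintegral_tsum fun j => (hm (j + 1)).aemeasurable]
    exact lintegral_mono fun x => tsum_noAlarm_le ω B x
  by_cases htop : ∑' j, q j = ⊤
  · rw [htop, top_le_iff] at hq
    rw [hq]; exact le_top
  have hlim : Tendsto q atTop (nhds 0) := ENNReal.tendsto_atTop_zero_of_tsum_ne_top htop
  have hB (n : ℕ) : ENNReal.ofReal B * (1 - q n) ≤ runLength (alarmTime ω B) := by
    refine le_trans ?_ ((ENNReal.sum_le_tsum (Finset.range (n + 1))).trans hq)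
    refine le_trans ?_ (stopped_statistic_le ω B n)
    refine le_add_left (le_of_eq ?_)
    rw [lintegral_sub (hm _) ((lintegral_mono fun x => noAlarm_le ω B _ x).trans_lt (by simp)).ne
      (ae_of_all _ fun x => noAlarm_le ω B _ x)]
    simp [q]
  have hlim2 : Tendsto (fun n => ENNReal.ofReal B * (1 - q n)) atTop
      (nhds (ENNReal.ofReal B * (1 - 0))) :=
    ENNReal.Tendsto.const_mul (ENNReal.Tendsto.sub tendsto_const_nhds hlim (by simp)) (by simp)
  simpa using le_of_tendsto' hlim2 hB

/-! ### Inversion of the Wald bound and asymptotics. -/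

/-- Inversion of `I t ≤ b + c log t + C` for large `b`. -/
theorem exists_le_of_mul_le_add_log {I c : ℝ} (hI : 0 < I) (hc : 0 ≤ c) (C : ℝ) :
    ∃ C' : ℝ, ∀ t b : ℝ, 0 < t → 1 ≤ b → I * t ≤ b + c * Real.log t + C →
      I * t ≤ b + c * Real.log b + C' := by
  refine ⟨C + c * Real.log (2 / I * (1 + |C| + c * |Real.log (I / (2 * (c + 1)))|)),
    fun t b ht hb h => ?_⟩
  -- With this slope `c * log t` is absorbed by half of `I * t`, so `t = O(b)`; inserting this into
  -- the logarithm gives the sharper bound.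
  set s := I / (2 * (c + 1)) with hs
  have hs0 : 0 < s := by positivity
  have hcs : c * (s * t) ≤ I * t / 2 := by
    have : c * s ≤ I / 2 := by
      rw [hs, ← mul_div_assoc, div_le_div_iff₀ (by positivity) (by norm_num)]; nlinarith
    nlinarith
  have h1 : Real.log t ≤ s * t - 1 - Real.log s := by
    have := Real.log_le_sub_one_of_pos (mul_pos hs0 ht)
    rw [Real.log_mul hs0.ne' ht.ne'] at this
    linarith
  have h2 : I * t / 2 ≤ b + C - c * Real.log s := by nlinarith [mul_le_mul_of_nonneg_left h1 hc]
  set D := 1 + |C| + c * |Real.log s| with hD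
  have hD1 : 0 < D := by positivity
  have h3 : t ≤ 2 / I * D * b := by
    have e1 : b + C - c * Real.log s ≤ D * b := by
      have a1 := le_abs_self C
      have a2 := mul_le_mul_of_nonneg_left (neg_abs_le (Real.log s)) hc
      have a3 : |C| ≤ |C| * b := le_mul_of_one_le_right (abs_nonneg _) hb
      have a4 : c * |Real.log s| ≤ c * |Real.log s| * b :=
        le_mul_of_one_le_right (by positivity) hb
      rw [hD]; nlinarith
    rw [div_mul_eq_mul_div, div_mul_eq_mul_div, le_div_iff₀ hI]
    linarith
  have h4 : Real.log t ≤ Real.log (2 / I * D) + Real.log b := by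
    rw [← Real.log_mul (by positivity) (by positivity)]
    exact Real.log_le_log ht h3
  nlinarith [mul_le_mul_of_nonneg_left h4 hc]

theorem exists_lintegral_duration_le {ω μ : Fin p → ℝ} (hω : ∀ k, 0 < ω k) (hμ : ∀ k, 0 ≤ μ k)
    (hne : ∀ k, μ k ≠ ω k) (hI : 0 < info ω μ) {δ : ℝ} (hδ : 0 < δ) :
    ∃ C : ℝ, ∀ B : ℝ, 1 ≤ B → 1 ≤ Real.log B →
      ∫⁻ x, duration ω B x ∂(streamLaw fun _ => μ) ≤ ENNReal.ofReal
        ((Real.log B + (((exceedSet ω μ).card : ℝ) / 2 + δ) * Real.log (Real.log B) + C) /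
          info ω μ) := by
  obtain ⟨C, hC⟩ := exists_wald_bound (fun k => gaussianNoise_streamLaw μ k) hω hμ hne hδ
  obtain ⟨C', hC'⟩ := exists_le_of_mul_le_add_log hI
    (by positivity : 0 ≤ ((exceedSet ω μ).card : ℝ) / 2 + δ) C
  refine ⟨C', fun B hB1 hB => lintegral_duration_le ω μ fun M hM => ?_⟩
  rw [le_div_iff₀ hI, mul_comm]
  refine hC' _ _ ?_ hB
    (hC _ _ (stopWeight_notReached ω B) (notReached_zero ω B) M hM
      (exists_last_notReached ω μ hB1 hM))
  have := Finset.single_le_sum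
    (f := fun l => ∫ x, notReached ω B l x ∂(streamLaw fun _ => μ))
    (fun i _ => integral_nonneg ((stopWeight_notReached ω B).nonneg i)) (Finset.mem_range.2 hM)
  refine lt_of_lt_of_le one_pos ?_
  simpa [notReached_zero] using this

/-- Only the positive part of `f` has to be small, so one-sided bounds suffice for an error term. -/
theorem exists_isLittleO_of_forall_eventually_le {f g : ℝ → ℝ} (hg : ∀ᶠ B in atTop, 0 ≤ g B)
    (h : ∀ δ > 0, ∀ᶠ B in atTop, f B ≤ δ * g B) :
    ∃ err : ℝ → ℝ, err =o[atTop] g ∧ ∀ B, f B ≤ err B := by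
  refine ⟨fun B => max (f B) 0, isLittleO_iff.2 fun δ hδ => ?_, fun B => le_max_left _ _⟩
  filter_upwards [hg, h δ hδ] with B h1 h2
  rw [Real.norm_of_nonneg (le_max_right _ _), Real.norm_of_nonneg h1]
  exact max_le h2 (by positivity)

end SRRS

end

theorem theorem4 {p : ℕ} (ω : Fin p → ℝ) (hω : ∀ k, 0 < ω k) :
    (∀ B : ℝ, 0 < B → ENNReal.ofReal B ≤ SRRS.runLength (SRRS.alarmTime ω B)) ∧
    ∀ μ : Fin p → ℝ, (∀ k, 0 ≤ μ k) → (∀ k, μ k ≠ ω k) → 0 < SRRS.info ω μ →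
      ∃ err : ℝ → ℝ,
        err =o[atTop] (fun B : ℝ =>
          ((SRRS.exceedSet ω μ).card : ℝ) * Real.log (Real.log B)) ∧
        ∀ᶠ B : ℝ in atTop,
          SRRS.detectionDelay μ (SRRS.alarmTime ω B) ≠ ⊤ ∧
          (SRRS.detectionDelay μ (SRRS.alarmTime ω B)).toReal ≤
            (Real.log B + ((SRRS.exceedSet ω μ).card : ℝ) / 2 * Real.log (Real.log B)
                - ((SRRS.exceedSet ω μ).card : ℝ) / 2 * Real.log (SRRS.info ω μ))
              / SRRS.info ω μ + err B := by
  refine ⟨fun B _ => SRRS.ofReal_le_runLength ω B, fun μ hμ hne hI => ?_⟩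
  have hbound : ∀ δ > 0, ∃ C : ℝ, ∀ᶠ B : ℝ in atTop, 0 ≤ Real.log (Real.log B) ∧
      SRRS.detectionDelay μ (SRRS.alarmTime ω B) ≠ ⊤ ∧
      (SRRS.detectionDelay μ (SRRS.alarmTime ω B)).toReal ≤
        (Real.log B + (((SRRS.exceedSet ω μ).card : ℝ) / 2 + δ) * Real.log (Real.log B) + C) /
          SRRS.info ω μ := by
    intro δ hδ
    obtain ⟨C, hC⟩ := SRRS.exists_lintegral_duration_le hω hμ hne hI hδ
    refine ⟨|C|, ?_⟩
    filter_upwards [Real.tendsto_log_atTop.eventually_ge_atTop 1, eventually_ge_atTop 1]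
      with B hB hB1
    have hll : 0 ≤ Real.log (Real.log B) := Real.log_nonneg hB
    have h1 : SRRS.detectionDelay μ (SRRS.alarmTime ω B) ≤ ENNReal.ofReal
        ((Real.log B + (((SRRS.exceedSet ω μ).card : ℝ) / 2 + δ) * Real.log (Real.log B) + |C|) /
          SRRS.info ω μ) :=
      (SRRS.detectionDelay_le ω μ B).trans ((hC B hB1 hB).trans (ENNReal.ofReal_le_ofReal
        (by gcongr; exact le_abs_self C)))
    refine ⟨hll, ne_top_of_le_ne_top ENNReal.ofReal_ne_top h1,
      ENNReal.toReal_le_of_le_ofReal (by positivity) h1⟩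
  set r : ℝ := ((SRRS.exceedSet ω μ).card : ℝ) with hr
  -- `I > 0` forces `Ω` to be nonempty, so `r * log (log B)` really tends to infinity and absorbs
  -- constants.
  have hr1 : 1 ≤ r := by
    rw [hr, Nat.one_le_cast, Finset.one_le_card, Finset.nonempty_iff_ne_empty]
    intro h
    simp [SRRS.info, h] at hI
  have hll : Tendsto (fun B : ℝ => Real.log (Real.log B)) atTop atTop :=
    Real.tendsto_log_atTop.comp Real.tendsto_log_atTop
  have hlit : ∀ δ > 0, ∀ᶠ B : ℝ in atTop,
      (SRRS.detectionDelay μ (SRRS.alarmTime ω B)).toReal -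
        (Real.log B + r / 2 * Real.log (Real.log B) - r / 2 * Real.log (SRRS.info ω μ)) /
          SRRS.info ω μ ≤ δ * (r * Real.log (Real.log B)) := by
    intro δ hδ
    -- Half of the allowance `δ * I * log (log B)` pays for the excess coefficient, the other half
    -- for `C` and the `log I` term.
    obtain ⟨C, hC⟩ := hbound (δ * SRRS.info ω μ / 2) (by positivity)
    filter_upwards [hC, hll.eventually_ge_atTop
      ((C + r / 2 * Real.log (SRRS.info ω μ)) / (δ * SRRS.info ω μ / 2))] with B hB h2
    rw [div_le_iff₀ (by positivity)] at h2
    have h3 := hB.2.2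
    rw [sub_le_iff_le_add]
    refine h3.trans ?_
    rw [div_le_iff₀ hI, add_mul (δ * _), div_mul_cancel₀ _ hI.ne']
    have h4 : δ * SRRS.info ω μ * Real.log (Real.log B) ≤
        r * (δ * SRRS.info ω μ * Real.log (Real.log B)) :=
      le_mul_of_one_le_left (mul_nonneg (by positivity) hB.1) hr1
    nlinarith
  obtain ⟨err, h1, h2⟩ := SRRS.exists_isLittleO_of_forall_eventually_le
    (g := fun B => r * Real.log (Real.log B)) (by
      filter_upwards [hll.eventually_ge_atTop 0] with B hB
      positivity) hlit
  refine ⟨err, h1, ?_⟩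
  obtain ⟨C, hC⟩ := hbound 1 one_pos
  filter_upwards [hC] with B hB
  exact ⟨hB.2.1, by linarith [h2 B]⟩
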